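/- **Proposition (Capital injection policy).** Let $c,a,b,\eta,\rho>0$, $\delta>1$ and $y\ge b$. On a probability space $(\Omega,\mathcal F,\mathbb P)$ with a complete and right-continuous filtration $\mathbb F=(\mathcal F_t)_{t\ge 0}$, let $N$ be an adapted counting process ($N_0=0$, unit jumps) whose $\mathbb F$-intensity $\lambda$ solves $d\lambda_t=a(b-\lambda_t)\,dt+\eta\,dN_t$, $\lambda_0=y$, and let $(Y_k)_{k\ge 1}$ be positive i.i.d. claim sizes with a density, independent of $N$, such that $\sum_{k\le N_t}Y_k$ is adapted. For $x\in\mathbb R$ put $R^x_t=x+ct-\sum_{k=1}^{N_t}Y_k$. A strategy $\alpha=(Z,K)$ consists of adapted non-decreasing processes with $Z_{0^-}=K_{0^-}=0$, $Z$ càdlàg (cumulative dividends) and $K$ càglàd (cumulative capital injections). The surplus is $X_t=R^x_t-Z_t+K_t$, with $X_{0^-}=x$ and $R^0_{0^-}=0$; because $K$ is left-continuous, $X_t$ is the surplus just before, and $X_{t^+}$ the surplus just after, an injection made at time $t$. The strategy is admissible for $x$ if $Z_t-Z_{t^-}\le \big(X_{t^-}+R^0_t-R^0_{t^-}\big)^+$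 for all $t\ge 0$. Let $T^\alpha=\inf\{t\ge 0: X_{t^+}<0\}$ be the ruin time, $$J_\alpha(x,y)=\mathbb E\Big[\int_{[0,T^\alpha]}e^{-\rho s}\,dZ_s-\delta\int_{[0,T^\alpha]}e^{-\rho s}\,dK_s\Big],$$ where the time integrals run over $s<\infty$ and $J_\alpha(x,y)=-\infty$ if the expected discounted injections are infinite, and let $v(x,y)=\sup_\alpha J_\alpha(x,y)$ over all admissible $\alpha$. Then injecting capital is optimal only when it is strictly necessary to prevent ruin: 1. for all $x\ge 0$ and $\kappa>0$, $$v(x+\kappa,y)-\delta\kappa<v(x,y);$$ 2. for every $x\in\mathbb R$ and every optimal strategy $\alpha=(Z,K)$, that is, every admissible $\alpha$ with $J_\alpha(x,y)=v(x,y)$, almost surely, for $dK$-almost every $t\in[0,T^\alpha]$, one has $X_t<0$ and $X_{t^+}=0$. So up to ruin capital is injected only at times $t$ at which the surplus is negative before the injection, and the injection brings the surplus exactly to $0$. -/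

import Mathlib

open MeasureTheory ProbabilityTheory Set
open scoped NNReal ENNReal

/-- The constants of the model: premium rate `c`, mean-reversion speed `a`, long-term intensity
level `b`, excitation size `η`, discount rate `ρ` and proportional injection cost `δ`. -/
structure RiskParams where
  c : ℝ
  a : ℝ
  b : ℝ
  η : ℝ
  ρ : ℝ
  δ : ℝ
  c_pos : 0 < c
  a_pos : 0 < a
  b_pos : 0 < b
  η_pos : 0 < η
  ρ_pos : 0 < ρ
  one_lt_δ : 1 < δ

/-- Claims arriving according to a Hawkes process with exponential kernel and initial intensity
`y`, on a probability space `(Ω, P)` with a complete right-continuous filtration `𝔽`.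
`Y k` is the size of the `(k + 1)`-st claim. -/
structure HawkesClaims (p : RiskParams) (y : ℝ) {Ω : Type*} [m : MeasurableSpace Ω]
    (P : Measure Ω) (𝔽 : Filtration ℝ≥0 m) where
  /-- number of claims up to time `t` -/
  N : ℝ≥0 → Ω → ℕ
  /-- claim sizes -/
  Y : ℕ → Ω → ℝ
  /-- claim arrival intensity -/
  intensity : ℝ≥0 → Ω → ℝ
  filtration_rightContinuous : 𝔽.IsRightContinuous
  filtration_complete : ∀ s : Set Ω, P s = 0 → MeasurableSet[𝔽 0] s
  -- `N` is a counting process: from `0`, càdlàg, with jumps of size one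
  N_zero : ∀ ω, N 0 ω = 0
  N_mono : ∀ ω, Monotone fun t => N t ω
  N_rightContinuous : ∀ ω t, ContinuousWithinAt (fun s => N s ω) (Ici t) t
  N_jump : ∀ ω t, 0 < t → N t ω ≤ Function.leftLim (fun s => N s ω) t + 1
  N_adapted : Adapted 𝔽 N
  -- `dλ = a (b - λ) dt + η dN` with `λ₀ = y`
  intensity_integrable : ∀ ω (t : ℝ≥0),
    IntervalIntegrable (fun s : ℝ => intensity s.toNNReal ω) volume 0 t
  intensity_eq : ∀ ω (t : ℝ≥0), intensity t ω =
    y + (∫ s in (0 : ℝ)..t, p.a * (p.b - intensity s.toNNReal ω)) + p.η * (N t ω : ℝ)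
  -- `λ` is the `𝔽`-intensity of `N`
  intensity_compensates : Martingale
    (fun (t : ℝ≥0) ω => (N t ω : ℝ) - ∫ s in (0 : ℝ)..t, intensity s.toNNReal ω) 𝔽 P
  -- the claim sizes are positive, i.i.d. with a density, and independent of `N`
  Y_measurable : ∀ k, Measurable (Y k)
  Y_pos : ∀ k ω, 0 < Y k ω
  Y_density : ∃ f : ℝ → ℝ≥0∞, Measurable f ∧ ∀ k, P.map (Y k) = volume.withDensity f
  Y_indep : iIndepFun Y P
  Y_indep_N : IndepFun (fun ω k => Y k ω) (fun ω t => N t ω) P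
  claims_adapted : Adapted 𝔽 fun t ω => ∑ k ∈ Finset.range (N t ω), Y k ω

/-- A pair of cumulative dividend (`Z`) and capital injection (`K`) processes: `Z` is
non-decreasing and càdlàg with `Z_{0-} = 0`; `K` is non-decreasing and càglàd with `K_{0-} = 0`
(so that `K₀ = 0`, and an injection made at time `0` appears in `K_{0+}`). -/
structure Strategy (Ω : Type*) where
  Z : ℝ≥0 → Ω → ℝ
  K : ℝ≥0 → Ω → ℝ
  Z_mono : ∀ ω, Monotone fun t => Z t ω
  Z_rightContinuous : ∀ ω t, ContinuousWithinAt (fun s => Z s ω) (Ici t) t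
  Z_zero_nonneg : ∀ ω, 0 ≤ Z 0 ω
  K_mono : ∀ ω, Monotone fun t => K t ω
  K_leftContinuous : ∀ ω t, ContinuousWithinAt (fun s => K s ω) (Iic t) t
  K_zero : ∀ ω, K 0 ω = 0

/-- The left limit `g_{t-}` of a path on `[0, ∞)`, where `g_{0-}` is the prescribed value `g₀`. -/
noncomputable def prelimit (g₀ : ℝ) (g : ℝ≥0 → ℝ) (t : ℝ≥0) : ℝ :=
  if t = 0 then g₀ else Function.leftLim g t

/-- A path on `[0, ∞)`, extended by `0` to negative times. -/
noncomputable def extendZero (g : ℝ≥0 → ℝ) (t : ℝ) : ℝ :=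
  if t < 0 then 0 else g t.toNNReal

theorem extendZero_mono {g : ℝ≥0 → ℝ} (hg : Monotone g) (h0 : 0 ≤ g 0) :
    Monotone (extendZero g) := by
  intro s t hst
  unfold extendZero
  split_ifs with hs ht ht
  · exact le_rfl
  · exact h0.trans (hg zero_le)
  · exact absurd (hst.trans_lt ht) hs
  · exact hg (Real.toNNReal_mono hst)

/-- The Lebesgue-Stieltjes measure `dg` of a non-decreasing path with `g_{0-} = 0`. It satisfies
`dg [0, t] = g_{t+}`; in particular its atom at `0` is `g_{0+}`. -/
noncomputable def pathMeasure {g : ℝ≥0 → ℝ} (hg : Monotone g) (h0 : 0 ≤ g 0) : Measure ℝ :=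
  (extendZero_mono hg h0).stieltjesFunction.measure

namespace Strategy

variable {Ω : Type*}

/-- The measure `dZ` on the time axis. -/
noncomputable def dZ (α : Strategy Ω) (ω : Ω) : Measure ℝ :=
  pathMeasure (α.Z_mono ω) (α.Z_zero_nonneg ω)

/-- The measure `dK` on the time axis. -/
noncomputable def dK (α : Strategy Ω) (ω : Ω) : Measure ℝ :=
  pathMeasure (α.K_mono ω) (α.K_zero ω).ge

end Strategy

namespace HawkesClaims

variable {p : RiskParams} {y : ℝ} {Ω : Type*} [m : MeasurableSpace Ω] {P : Measure Ω}
  {𝔽 : Filtration ℝ≥0 m}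

/-- The uncontrolled surplus `R^x_t = x + c t - ∑_{k ≤ N_t} Y_k`. -/
noncomputable def reserve (M : HawkesClaims p y P 𝔽) (x : ℝ) (t : ℝ≥0) (ω : Ω) : ℝ :=
  x + p.c * t - ∑ k ∈ Finset.range (M.N t ω), M.Y k ω

/-- The controlled surplus `X_t = R^x_t - Z_t + K_t`. As `K` is left-continuous, `X_t` does not
yet contain a lump-sum injection made at time `t`, whereas `X_{t+}` does. -/
noncomputable def surplus (M : HawkesClaims p y P 𝔽) (x : ℝ) (α : Strategy Ω)
    (t : ℝ≥0) (ω : Ω) : ℝ :=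
  M.reserve x t ω - α.Z t ω + α.K t ω

/-- The surplus `X_{t+}` immediately after time `t`. -/
noncomputable def surplusAfter (M : HawkesClaims p y P 𝔽) (x : ℝ) (α : Strategy Ω)
    (t : ℝ≥0) (ω : Ω) : ℝ :=
  Function.rightLim (fun s => M.surplus x α s ω) t

/-- Admissible strategies: adapted, and a lump-sum dividend never exceeds the available reserve,
`Z_t - Z_{t-} ≤ (X_{t-} + R⁰_t - R⁰_{t-})⁺`, with `Z_{0-} = 0`, `X_{0-} = x`, `R⁰_{0-} = 0`. -/
structure IsAdmissible (M : HawkesClaims p y P 𝔽) (x : ℝ) (α : Strategy Ω) : Prop where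
  Z_adapted : Adapted 𝔽 α.Z
  K_adapted : Adapted 𝔽 α.K
  dividend_le : ∀ ω t,
    α.Z t ω - prelimit 0 (fun s => α.Z s ω) t ≤
      max 0 (prelimit x (fun s => M.surplus x α s ω) t
        + M.reserve 0 t ω - prelimit 0 (fun s => M.reserve 0 s ω) t)

/-- The ruin time `T = inf {t ≥ 0 : X_{t+} < 0}`, infinite if there is no such `t`. -/
noncomputable def ruinTime (M : HawkesClaims p y P 𝔽) (x : ℝ) (α : Strategy Ω) (ω : Ω) : ℝ≥0∞ :=
  sInf {s | ∃ t : ℝ≥0, s = t ∧ M.surplusAfter x α t ω < 0}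

/-- The expected discounted dividends `E ∫_{[0,T]} e^{-ρ s} dZ_s`. -/
noncomputable def expectedDividends (M : HawkesClaims p y P 𝔽) (x : ℝ) (α : Strategy Ω) : ℝ≥0∞ :=
  ∫⁻ ω, ∫⁻ s in {s : ℝ | ENNReal.ofReal s ≤ M.ruinTime x α ω},
    ENNReal.ofReal (Real.exp (-p.ρ * s)) ∂(α.dZ ω) ∂P

/-- The expected discounted injections `E ∫_{[0,T]} e^{-ρ s} dK_s`. -/
noncomputable def expectedInjections (M : HawkesClaims p y P 𝔽) (x : ℝ) (α : Strategy Ω) : ℝ≥0∞ :=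
  ∫⁻ ω, ∫⁻ s in {s : ℝ | ENNReal.ofReal s ≤ M.ruinTime x α ω},
    ENNReal.ofReal (Real.exp (-p.ρ * s)) ∂(α.dK ω) ∂P

/-- The reward `J_α(x, y)`. A strategy with infinite expected injection cost has reward `-∞`
(in `EReal`, `⊤ - ⊤ = ⊥`). -/
noncomputable def reward (M : HawkesClaims p y P 𝔽) (x : ℝ) (α : Strategy Ω) : EReal :=
  (M.expectedDividends x α : EReal) - (p.δ : EReal) * (M.expectedInjections x α : EReal)

/-- The value function `v(x, y)`, the supremum of the reward over the admissible strategies. -/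
noncomputable def value (M : HawkesClaims p y P 𝔽) (x : ℝ) : EReal :=
  ⨆ (α : Strategy Ω) (_ : M.IsAdmissible x α), M.reward x α

end HawkesClaims

/-!
Discounting at rate `ρ` amounts to killing at an independent exponential time, so the reward of a
strategy is the expectation of the dividends paid minus `δ` times the capital injected up to that
time or ruin, whichever comes first. Injections can be deferred to the next claim: until then the
cumulative dividends `Z` are reduced to the running maximum of `Z - k`, where `k` is the capital
deferred so far, and at the claim one injects the part of `k` that the withheld dividends have not
made up for. Ruin occurs no sooner, and if the exponential time comes before the claim, each unit
still deferred has saved its cost `δ > 1` against at most one unit of withheld dividends. Hence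
deferring is strictly profitable as soon as capital is deferred with positive probability.

For the first part, the initial capital `κ` is deferred to the first claim, which the exponential
time precedes with positive probability. For the second part, one defers what an optimal strategy
injects after the `n`-th claim in excess of the shortfall `(-X)⁺` at that claim. By optimality this
excess vanishes, as does a lump-sum injection at the time of ruin, so that capital is only injected
at time `0` and at claim times, to cover the shortfall there.
-/

open Filter Topology

/-! ### Stopped times and one-sided limits -/

/-- The minimum `t ∧ T` of a finite time `t` and a possibly infinite time `T`. -/
noncomputable def stopTime (T : ℝ≥0∞) (t : ℝ≥0) : ℝ≥0 := (min (t : ℝ≥0∞) T).toNNReal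

theorem coe_stopTime (T : ℝ≥0∞) (t : ℝ≥0) : (stopTime T t : ℝ≥0∞) = min (t : ℝ≥0∞) T :=
  ENNReal.coe_toNNReal (ne_top_of_le_ne_top ENNReal.coe_ne_top (min_le_left _ _))

theorem stopTime_le (T : ℝ≥0∞) (t : ℝ≥0) : stopTime T t ≤ t := by
  rw [← ENNReal.coe_le_coe, coe_stopTime]
  exact min_le_left _ _

theorem coe_stopTime_le (T : ℝ≥0∞) (t : ℝ≥0) : (stopTime T t : ℝ≥0∞) ≤ T := by
  rw [coe_stopTime]
  exact min_le_right _ _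

theorem stopTime_of_le {T : ℝ≥0∞} {t : ℝ≥0} (h : (t : ℝ≥0∞) ≤ T) : stopTime T t = t := by
  rw [stopTime, min_eq_left h, ENNReal.toNNReal_coe]

theorem stopTime_of_ge {T : ℝ≥0∞} {t : ℝ≥0} (h : T ≤ t) : stopTime T t = T.toNNReal := by
  rw [stopTime, min_eq_right h]

theorem stopTime_top (t : ℝ≥0) : stopTime ⊤ t = t := stopTime_of_le le_top

theorem stopTime_coe (s t : ℝ≥0) : stopTime s t = min t s := by
  rw [← ENNReal.coe_inj, coe_stopTime, ENNReal.coe_min]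

theorem stopTime_zero (T : ℝ≥0∞) : stopTime T 0 = 0 := stopTime_of_le (by simp)

theorem stopTime_mono (T : ℝ≥0∞) : Monotone (stopTime T) := fun s t hst => by
  rw [← ENNReal.coe_le_coe, coe_stopTime, coe_stopTime]
  exact min_le_min_right _ (ENNReal.coe_le_coe.2 hst)

theorem continuous_stopTime (T : ℝ≥0∞) : Continuous (stopTime T) := by
  induction T with
  | top => exact (funext stopTime_top : stopTime ⊤ = id) ▸ continuous_id
  | coe s =>
    rw [funext (stopTime_coe s)]
    exact continuous_id.min continuous_const

theorem le_stopTime {T : ℝ≥0∞} {s t : ℝ≥0} (hst : s ≤ t) (hs : (s : ℝ≥0∞) ≤ T) :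
    s ≤ stopTime T t :=
  (stopTime_of_le hs).ge.trans (stopTime_mono T hst)

section OneSidedLimits

variable {β : Type*} [TopologicalSpace β] {g : ℝ≥0 → β} {t : ℝ≥0}

theorem continuousWithinAt_comp_stopTime_Ici (hg : ∀ t, ContinuousWithinAt g (Ici t) t)
    (T : ℝ≥0∞) (t : ℝ≥0) : ContinuousWithinAt (fun s => g (stopTime T s)) (Ici t) t :=
  (hg _).comp (continuous_stopTime T).continuousWithinAt fun _ hs => stopTime_mono T hs

theorem continuousWithinAt_comp_stopTime_Iic (hg : ∀ t, ContinuousWithinAt g (Iic t) t)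
    (T : ℝ≥0∞) (t : ℝ≥0) : ContinuousWithinAt (fun s => g (stopTime T s)) (Iic t) t :=
  (hg _).comp (continuous_stopTime T).continuousWithinAt fun _ hs => stopTime_mono T hs

theorem rightLim_eq_of_continuousWithinAt_Ici [T2Space β] (hg : ContinuousWithinAt g (Ici t) t) :
    Function.rightLim g t = g t :=
  rightLim_eq_of_tendsto (hg.mono Ioi_subset_Ici_self)

end OneSidedLimits

theorem neBot_nhdsLT {t : ℝ≥0} (ht : t ≠ 0) : (𝓝[<] t).NeBot :=
  nhdsLT_neBot_of_exists_lt ⟨0, pos_iff_ne_zero.2 ht⟩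

theorem prelimit_zero (g₀ : ℝ) (g : ℝ≥0 → ℝ) : prelimit g₀ g 0 = g₀ := if_pos rfl

theorem prelimit_eq_of_tendsto {g₀ l : ℝ} {g : ℝ≥0 → ℝ} {t : ℝ≥0} (ht : t ≠ 0)
    (h : Tendsto g (𝓝[<] t) (𝓝 l)) : prelimit g₀ g t = l := by
  have := neBot_nhdsLT ht
  rw [prelimit, if_neg ht]
  exact leftLim_eq_of_tendsto h

theorem prelimit_of_continuousWithinAt_Iic {g : ℝ≥0 → ℝ} {t : ℝ≥0}
    (hg : ContinuousWithinAt g (Iic t) t) : prelimit (g 0) g t = g t := by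
  rcases eq_or_ne t 0 with rfl | ht
  · exact prelimit_zero _ _
  · exact prelimit_eq_of_tendsto ht (hg.mono Iio_subset_Iic_self)

theorem tendsto_prelimit {g : ℝ≥0 → ℝ} (hg : Monotone g) (g₀ : ℝ) {t : ℝ≥0} (ht : t ≠ 0) :
    Tendsto g (𝓝[<] t) (𝓝 (prelimit g₀ g t)) := by
  rw [prelimit, if_neg ht]
  exact hg.tendsto_leftLim t

theorem prelimit_comp_stopTime {g : ℝ≥0 → ℝ} (hg : Monotone g) (g₀ : ℝ) {T : ℝ≥0∞} {t : ℝ≥0}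
    (h : t ≤ T) : prelimit g₀ (fun s => g (stopTime T s)) t = prelimit g₀ g t := by
  rcases eq_or_ne t 0 with rfl | ht
  · rw [prelimit_zero, prelimit_zero]
  · refine prelimit_eq_of_tendsto ht ((tendsto_prelimit hg g₀ ht).congr' ?_)
    filter_upwards [self_mem_nhdsWithin] with s hs
    rw [stopTime_of_le ((ENNReal.coe_le_coe.2 (le_of_lt hs)).trans h)]

/-! ### The Stieltjes measure of a path -/

theorem extendZero_of_neg (g : ℝ≥0 → ℝ) {t : ℝ} (ht : t < 0) : extendZero g t = 0 := if_pos ht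

theorem extendZero_of_nonneg (g : ℝ≥0 → ℝ) {t : ℝ} (ht : 0 ≤ t) :
    extendZero g t = g t.toNNReal := if_neg ht.not_gt

theorem tendsto_extendZero_nhdsGT {g : ℝ≥0 → ℝ} {l : ℝ} {u : ℝ≥0}
    (h : Tendsto g (𝓝[>] u) (𝓝 l)) : Tendsto (extendZero g) (𝓝[>] (u : ℝ)) (𝓝 l) := by
  have toNNReal_right : Tendsto Real.toNNReal (𝓝[>] (u : ℝ)) (𝓝[>] u) := by
    conv_rhs => rw [← Real.toNNReal_coe (r := u)]
    exact continuous_real_toNNReal.continuousWithinAt.tendsto_nhdsWithin fun s hs => by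
      simpa [Real.lt_toNNReal_iff_coe_lt] using hs
  refine (h.comp toNNReal_right).congr' ?_
  filter_upwards [self_mem_nhdsWithin] with s hs
  exact (extendZero_of_nonneg g (u.2.trans (le_of_lt hs))).symm

theorem tendsto_extendZero_nhdsLT {g : ℝ≥0 → ℝ} {l : ℝ} {u : ℝ≥0} (hu : 0 < u)
    (h : Tendsto g (𝓝[<] u) (𝓝 l)) : Tendsto (extendZero g) (𝓝[<] (u : ℝ)) (𝓝 l) := by
  have toNNReal_left : Tendsto Real.toNNReal (𝓝[<] (u : ℝ)) (𝓝[<] u) := by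
    conv_rhs => rw [← Real.toNNReal_coe (r := u)]
    exact continuous_real_toNNReal.continuousWithinAt.tendsto_nhdsWithin fun s hs =>
      (Real.toNNReal_lt_toNNReal_iff (NNReal.coe_pos.2 hu)).2 hs
  refine (h.comp toNNReal_left).congr' ?_
  filter_upwards [mem_nhdsWithin_of_mem_nhds (lt_mem_nhds (NNReal.coe_pos.2 hu))] with s hs
  exact (extendZero_of_nonneg g (le_of_lt hs)).symm

theorem rightLim_extendZero {g : ℝ≥0 → ℝ} (hg : Monotone g) (u : ℝ≥0) :
    Function.rightLim (extendZero g) u = Function.rightLim g u :=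
  rightLim_eq_of_tendsto (tendsto_extendZero_nhdsGT (hg.tendsto_rightLim u))

theorem leftLim_extendZero {g : ℝ≥0 → ℝ} (hg : Monotone g) (u : ℝ≥0) :
    Function.leftLim (extendZero g) u = prelimit 0 g u := by
  refine leftLim_eq_of_tendsto ?_
  rcases eq_zero_or_pos u with rfl | hu
  · rw [prelimit_zero]
    exact tendsto_const_nhds.congr'
      (eventually_nhdsWithin_of_forall fun s hs => (extendZero_of_neg g hs).symm)
  · exact tendsto_extendZero_nhdsLT hu (tendsto_prelimit hg 0 hu.ne')

theorem leftLim_stieltjesFunction {f : ℝ → ℝ} (hf : Monotone f) (s : ℝ) :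
    Function.leftLim hf.stieltjesFunction s = Function.leftLim f s :=
  le_antisymm
    (le_of_tendsto (hf.stieltjesFunction.mono.tendsto_leftLim s)
      (eventually_nhdsWithin_of_forall fun _ hr => hf.rightLim_le_leftLim hr))
    (le_of_tendsto_of_tendsto' (hf.tendsto_leftLim s)
      (hf.stieltjesFunction.mono.tendsto_leftLim s) fun _ => hf.le_rightLim le_rfl)

section PathMeasure

variable {g : ℝ≥0 → ℝ} (hg : Monotone g) (h0 : 0 ≤ g 0)

instance sFinite_pathMeasure : SFinite (pathMeasure hg h0) :=
  inferInstanceAs (SFinite (extendZero_mono hg h0).stieltjesFunction.measure)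

theorem tendsto_stieltjesFunction_extendZero_atBot :
    Tendsto (extendZero_mono hg h0).stieltjesFunction atBot (𝓝 0) := by
  refine tendsto_const_nhds.congr' ?_
  filter_upwards [Iio_mem_atBot (0 : ℝ)] with s hs
  refine (rightLim_eq_of_tendsto (tendsto_const_nhds.congr' ?_)).symm
  filter_upwards [mem_nhdsWithin_of_mem_nhds (Iio_mem_nhds hs)] with r hr
    using (extendZero_of_neg g hr).symm

theorem pathMeasure_Iic (u : ℝ≥0) :
    pathMeasure hg h0 (Iic (u : ℝ)) = ENNReal.ofReal (Function.rightLim g u) := by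
  rw [pathMeasure, StieltjesFunction.measure_Iic _
    (tendsto_stieltjesFunction_extendZero_atBot hg h0), Monotone.stieltjesFunction_eq,
    rightLim_extendZero hg, sub_zero]

theorem pathMeasure_Iio (u : ℝ≥0) :
    pathMeasure hg h0 (Iio (u : ℝ)) = ENNReal.ofReal (prelimit 0 g u) := by
  rw [pathMeasure, StieltjesFunction.measure_Iio _
    (tendsto_stieltjesFunction_extendZero_atBot hg h0), leftLim_stieltjesFunction,
    leftLim_extendZero hg, sub_zero]

theorem pathMeasure_singleton (u : ℝ≥0) :
    pathMeasure hg h0 {(u : ℝ)} = ENNReal.ofReal (Function.rightLim g u - prelimit 0 g u) := by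
  rw [pathMeasure, StieltjesFunction.measure_singleton, Monotone.stieltjesFunction_eq,
    leftLim_stieltjesFunction, rightLim_extendZero hg, leftLim_extendZero hg]

theorem pathMeasure_Ioo (s t : ℝ≥0) :
    pathMeasure hg h0 (Ioo (s : ℝ) t) =
      ENNReal.ofReal (prelimit 0 g t - Function.rightLim g s) := by
  rw [pathMeasure, StieltjesFunction.measure_Ioo, Monotone.stieltjesFunction_eq,
    leftLim_stieltjesFunction, rightLim_extendZero hg, leftLim_extendZero hg]

theorem pathMeasure_Iio_zero : pathMeasure hg h0 (Iio 0) = 0 := by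
  simpa [prelimit_zero] using pathMeasure_Iio hg h0 0

end PathMeasure

/-! ### Discounting as killing at an independent exponential time -/

/-- The law on `[0, ∞)` of an exponential time of rate `ρ`: discounting at rate `ρ` amounts to
stopping at an independent time with this law. -/
noncomputable def discountMeasure (ρ : ℝ) : Measure ℝ≥0 := (expMeasure ρ).map Real.toNNReal

section Discounting

variable {ρ : ℝ} (hρ : 0 < ρ)

include hρ

theorem isProbabilityMeasure_discountMeasure : IsProbabilityMeasure (discountMeasure ρ) :=
  have := isProbabilityMeasure_expMeasure hρ
  Measure.isProbabilityMeasure_map measurable_real_toNNReal.aemeasurable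

theorem discountMeasure_Ioi (s : ℝ≥0) :
    discountMeasure ρ (Ioi s) = ENNReal.ofReal (Real.exp (-ρ * s)) := by
  have := isProbabilityMeasure_expMeasure hρ
  have preimage_Ioi : Real.toNNReal ⁻¹' Ioi s = (Iic (s : ℝ))ᶜ := by
    ext u
    simp [Real.lt_toNNReal_iff_coe_lt]
  rw [discountMeasure, Measure.map_apply measurable_real_toNNReal measurableSet_Ioi, preimage_Ioi,
    prob_compl_eq_one_sub measurableSet_Iic, ← ofReal_cdf, cdf_expMeasure_eq hρ,
    if_pos s.coe_nonneg, ← ENNReal.ofReal_one,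
    ← ENNReal.ofReal_sub _ (sub_nonneg.2 (Real.exp_le_one_iff.2 (by
      simpa using mul_nonneg hρ.le s.coe_nonneg)))]
  congr 1
  rw [neg_mul]
  ring

theorem discountMeasure_singleton (s : ℝ≥0) : discountMeasure ρ {s} = 0 := by
  rcases eq_zero_or_pos s with rfl | hs
  · have := isProbabilityMeasure_discountMeasure hρ
    have compl_zero : ({0} : Set ℝ≥0)ᶜ = Ioi 0 := by
      ext
      simp [pos_iff_ne_zero]
    rw [← prob_compl_eq_one_iff (measurableSet_singleton 0), compl_zero, discountMeasure_Ioi hρ]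
    simp
  · have preimage_singleton : Real.toNNReal ⁻¹' {s} ⊆ {(s : ℝ)} := fun u hu =>
      (Real.toNNReal_eq_iff_eq_coe hs.ne').1 hu
    rw [discountMeasure, Measure.map_apply measurable_real_toNNReal (measurableSet_singleton s)]
    exact withDensity_absolutelyContinuous _ _ (measure_mono_null preimage_singleton (by simp))

theorem discountMeasure_Ici (s : ℝ≥0) :
    discountMeasure ρ (Ici s) = ENNReal.ofReal (Real.exp (-ρ * s)) := by
  have : NullSingletonClass (discountMeasure ρ) := ⟨discountMeasure_singleton hρ⟩
  rw [← discountMeasure_Ioi hρ, measure_congr Ioi_ae_eq_Ici]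

theorem discountMeasure_Ioc_pos {s t : ℝ≥0} (hst : s < t) : 0 < discountMeasure ρ (Ioc s t) := by
  have := isProbabilityMeasure_discountMeasure hρ
  have tail_lt : discountMeasure ρ (Ioi t) < discountMeasure ρ (Ioi s) := by
    rw [discountMeasure_Ioi hρ, discountMeasure_Ioi hρ,
      ENNReal.ofReal_lt_ofReal_iff (Real.exp_pos _), Real.exp_lt_exp]
    exact mul_lt_mul_of_neg_left (NNReal.coe_lt_coe.2 hst) (neg_lt_zero.2 hρ)
  rw [← Ioi_sdiff_Ioi, measure_sdiff (Ioi_subset_Ioi hst.le)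
    measurableSet_Ioi.nullMeasurableSet (measure_ne_top _ _)]
  exact tsub_pos_of_lt tail_lt

theorem exists_mem_Ioc_of_ae_discountMeasure {q : ℝ≥0 → Prop}
    (hq : ∀ᵐ u ∂discountMeasure ρ, q u) {s t : ℝ≥0} (hst : s < t) : ∃ u ∈ Ioc s t, q u := by
  by_contra! h
  exact (discountMeasure_Ioc_pos hρ hst).ne' (measure_mono_null (fun u hu => h u hu) hq)

theorem lintegral_coe_discountMeasure_lt_top : ∫⁻ u, (u : ℝ≥0∞) ∂discountMeasure ρ < ⊤ := by
  have layer_cake := lintegral_eq_lintegral_meas_lt (discountMeasure ρ)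
    (Eventually.of_forall fun u => NNReal.coe_nonneg u) (by fun_prop)
  have tail : ∀ t ∈ Ioi (0 : ℝ), discountMeasure ρ {u : ℝ≥0 | t < u} =
      ENNReal.ofReal (Real.exp (-ρ * t)) := fun t ht => by
    lift t to ℝ≥0 using le_of_lt ht
    simp only [NNReal.coe_lt_coe]
    exact discountMeasure_Ioi hρ t
  simp only [ENNReal.ofReal_coe_nnreal] at layer_cake
  rw [layer_cake, setLIntegral_congr_fun measurableSet_Ioi tail]
  exact (integrableOn_exp_mul_Ioi (neg_lt_zero.2 hρ) 0).lintegral_lt_top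

theorem lintegral_exp_eq_lintegral_discountMeasure {μ : Measure ℝ} [SFinite μ]
    (hμ : μ (Iio 0) = 0) {A : Set ℝ} (hA : MeasurableSet A) {S : Set (ℝ × ℝ≥0)}
    (hS : MeasurableSet S)
    (hS_tail : ∀ s : ℝ≥0, discountMeasure ρ (Prod.mk (s : ℝ) ⁻¹' S) =
      ENNReal.ofReal (Real.exp (-ρ * s))) :
    ∫⁻ s in A, ENNReal.ofReal (Real.exp (-ρ * s)) ∂μ =
      ∫⁻ u, μ (A ∩ {s | (s, u) ∈ S}) ∂discountMeasure ρ := by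
  have := isProbabilityMeasure_discountMeasure hρ
  have nonneg : ∀ᵐ s ∂μ, 0 ≤ s := measure_mono_null (fun s hs => by simpa using hs) hμ
  calc ∫⁻ s in A, ENNReal.ofReal (Real.exp (-ρ * s)) ∂μ
      = ∫⁻ s in A, discountMeasure ρ (Prod.mk s ⁻¹' S) ∂μ := by
        refine lintegral_congr_ae ?_
        filter_upwards [ae_restrict_of_ae nonneg] with s hs
        exact (hS_tail ⟨s, hs⟩).symm
    _ = ∫⁻ u, μ.restrict A {s | (s, u) ∈ S} ∂discountMeasure ρ := by
        rw [← Measure.prod_apply hS, Measure.prod_apply_symm hS]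
        rfl
    _ = ∫⁻ u, μ (A ∩ {s | (s, u) ∈ S}) ∂discountMeasure ρ :=
        lintegral_congr fun u => by rw [Measure.restrict_apply' hA, inter_comm]

end Discounting

theorem measurableSet_ofReal_le (T : ℝ≥0∞) : MeasurableSet {s : ℝ | ENNReal.ofReal s ≤ T} :=
  ENNReal.measurable_ofReal measurableSet_Iic

/-- The value `g_t` for `t ≤ T`, and `g_{T+}` for `t > T`: the path obtained from a left-continuous
`g` by stopping right after `T`, so that a jump of `g` immediately after `T` is kept. -/
noncomputable def stopAfter (g : ℝ≥0 → ℝ) (T : ℝ≥0∞) (t : ℝ≥0) : ℝ :=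
  if (t : ℝ≥0∞) ≤ T then g t else Function.rightLim g T.toNNReal

theorem stopAfter_of_le (g : ℝ≥0 → ℝ) {T : ℝ≥0∞} {t : ℝ≥0} (h : (t : ℝ≥0∞) ≤ T) :
    stopAfter g T t = g t := if_pos h

theorem stopAfter_of_lt (g : ℝ≥0 → ℝ) {T : ℝ≥0∞} {t : ℝ≥0} (h : T < t) :
    stopAfter g T t = Function.rightLim g T.toNNReal := if_neg h.not_ge

theorem le_stopAfter {g : ℝ≥0 → ℝ} (hg : Monotone g) (T : ℝ≥0∞) (t : ℝ≥0) :
    g (stopTime T t) ≤ stopAfter g T t := by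
  rcases le_or_gt (t : ℝ≥0∞) T with h | h
  · rw [stopTime_of_le h, stopAfter_of_le g h]
  · rw [stopTime_of_ge h.le, stopAfter_of_lt g h]
    exact hg.le_rightLim le_rfl

theorem stopAfter_le {g : ℝ≥0 → ℝ} (hg : Monotone g) (T : ℝ≥0∞) (t : ℝ≥0) :
    stopAfter g T t ≤ g t := by
  rcases le_or_gt (t : ℝ≥0∞) T with h | h
  · rw [stopAfter_of_le g h]
  · rw [stopAfter_of_lt g h]
    exact hg.rightLim_le ((ENNReal.toNNReal_lt_of_lt_coe h))

theorem tendsto_stopAfter {g : ℝ≥0 → ℝ} (hg : Monotone g) (T : ℝ≥0∞) (t : ℝ≥0) {u : ℕ → ℝ≥0}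
    (hu : Tendsto u atTop (𝓝[>] stopTime T t)) :
    Tendsto (fun n => g (min (u n) t)) atTop (𝓝 (stopAfter g T t)) := by
  rcases le_or_gt (t : ℝ≥0∞) T with h | h
  · rw [stopTime_of_le h] at hu
    rw [stopAfter_of_le g h]
    refine tendsto_const_nhds.congr' ?_
    filter_upwards [(tendsto_nhdsWithin_iff.1 hu).2] with n hn
    rw [min_eq_right (le_of_lt hn)]
  · have hlt : T.toNNReal < t := ENNReal.toNNReal_lt_of_lt_coe h
    rw [stopTime_of_ge h.le] at hu
    rw [stopAfter_of_lt g h]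
    refine ((hg.tendsto_rightLim _).comp hu).congr' ?_
    filter_upwards [hu.eventually (mem_nhdsWithin_of_mem_nhds (Iio_mem_nhds hlt))] with n hn
    rw [Function.comp_apply, min_eq_left (le_of_lt hn)]

section DiscountedPath

variable {g : ℝ≥0 → ℝ} (hg : Monotone g) (h0 : 0 ≤ g 0) {ρ : ℝ} (hρ : 0 < ρ) (T : ℝ≥0∞)

include hρ

theorem lintegral_exp_pathMeasure_of_rightContinuous
    (hgc : ∀ t, ContinuousWithinAt g (Ici t) t) :
    ∫⁻ s in {s : ℝ | ENNReal.ofReal s ≤ T}, ENNReal.ofReal (Real.exp (-ρ * s))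
        ∂pathMeasure hg h0 =
      ∫⁻ u, ENNReal.ofReal (g (stopTime T u)) ∂discountMeasure ρ := by
  rw [lintegral_exp_eq_lintegral_discountMeasure hρ (pathMeasure_Iio_zero hg h0)
    (measurableSet_ofReal_le T) (S := {z | z.1 ≤ z.2})
    (measurableSet_le measurable_fst (by fun_prop)) (by exact discountMeasure_Ici hρ)]
  refine lintegral_congr fun u => ?_
  rw [← rightLim_eq_of_continuousWithinAt_Ici (hgc (stopTime T u)), ← pathMeasure_Iic hg h0]
  congr 1
  ext s
  rw [mem_Iic, ← Real.toNNReal_le_iff_le_coe, ← ENNReal.coe_le_coe, coe_stopTime, le_min_iff,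
    ENNReal.coe_le_coe, Real.toNNReal_le_iff_le_coe]
  exact and_comm

theorem lintegral_exp_pathMeasure_of_leftContinuous
    (hgc : ∀ t, ContinuousWithinAt g (Iic t) t) (hg0 : g 0 = 0) :
    ∫⁻ s in {s : ℝ | ENNReal.ofReal s ≤ T}, ENNReal.ofReal (Real.exp (-ρ * s))
        ∂pathMeasure hg h0 =
      ∫⁻ u, ENNReal.ofReal (stopAfter g T u) ∂discountMeasure ρ := by
  rw [lintegral_exp_eq_lintegral_discountMeasure hρ (pathMeasure_Iio_zero hg h0)
    (measurableSet_ofReal_le T) (S := {z | z.1 < z.2})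
    (measurableSet_lt measurable_fst (by fun_prop)) (by exact discountMeasure_Ioi hρ)]
  refine lintegral_congr fun u => ?_
  rcases le_or_gt (u : ℝ≥0∞) T with h | h
  · have before : {s : ℝ | ENNReal.ofReal s ≤ T} ∩ {s | s < u} = Iio (u : ℝ) :=
      inter_eq_right.2 fun s hs => (ENNReal.ofReal_le_coe.2 (le_of_lt hs)).trans h
    rw [stopAfter_of_le g h, ← prelimit_of_continuousWithinAt_Iic (hgc u), hg0,
      ← pathMeasure_Iio hg h0]
    exact congrArg _ before
  · lift T to ℝ≥0 using h.ne_top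
    have after : {s : ℝ | ENNReal.ofReal s ≤ T} ∩ {s | s < u} = Iic (T : ℝ) := by
      ext s
      simp only [mem_inter_iff, mem_ofPred_eq, ENNReal.ofReal_le_coe, mem_Iic,
        and_iff_left_iff_imp]
      exact fun hs => hs.trans_lt (NNReal.coe_lt_coe.2 (ENNReal.coe_lt_coe.1 h))
    rw [stopAfter_of_lt g h, ENNReal.toNNReal_coe, ← pathMeasure_Iic hg h0]
    exact congrArg _ after

end DiscountedPath

/-! ### Optional times -/

section Sampling

variable {Ω β : Type*} {m : MeasurableSpace Ω} [LinearOrder β] [TopologicalSpace β]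
  [OrderTopology β] [SecondCountableTopology β] [MeasurableSpace β] [BorelSpace β]
  {f : ℝ≥0 → Ω → β} {θ : Ω → ℝ≥0} {t : ℝ≥0∞}

theorem measurable_eval_of_rightContinuous (hf : ∀ s : ℝ≥0, (s : ℝ≥0∞) ≤ t → Measurable (f s))
    (hf_mono : ∀ ω, Monotone fun s => f s ω)
    (hf_right : ∀ ω s, ContinuousWithinAt (fun s => f s ω) (Ici s) s)
    (hθ : Measurable θ) (hθt : ∀ ω, (θ ω : ℝ≥0∞) ≤ t) : Measurable fun ω => f (θ ω) ω := by
  refine measurable_of_Iio fun a => ?_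
  have eval_lt_iff : (fun ω => f (θ ω) ω) ⁻¹' Iio a = ⋃ q : ℚ,
      {ω | θ ω < Real.toNNReal q} ∩ f (stopTime t (Real.toNNReal q)) ⁻¹' Iio a := by
    ext ω
    simp only [mem_preimage, mem_Iio, mem_iUnion, mem_inter_iff, mem_ofPred_eq]
    constructor
    · intro h
      obtain ⟨r, hr, hlt⟩ := mem_nhdsGE_iff_exists_Ico_subset.1
        ((hf_right ω (θ ω)).eventually_lt_const h)
      obtain ⟨q, -, hθq, hqr⟩ := (NNReal.lt_iff_exists_rat_btwn _ _).1 (mem_Ioi.1 hr)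
      exact ⟨q, hθq, hlt ⟨le_stopTime hθq.le (hθt ω), (stopTime_le _ _).trans_lt hqr⟩⟩
    · rintro ⟨q, hθq, h⟩
      exact (hf_mono ω (le_stopTime hθq.le (hθt ω))).trans_lt h
  rw [eval_lt_iff]
  exact MeasurableSet.iUnion fun q => (measurableSet_lt hθ measurable_const).inter
    (hf _ (coe_stopTime_le _ _) measurableSet_Iio)

theorem measurable_eval_of_leftContinuous (hf : ∀ s : ℝ≥0, (s : ℝ≥0∞) ≤ t → Measurable (f s))
    (hf_mono : ∀ ω, Monotone fun s => f s ω)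
    (hf_left : ∀ ω s, ContinuousWithinAt (fun s => f s ω) (Iic s) s)
    (hθ : Measurable θ) (hθt : ∀ ω, (θ ω : ℝ≥0∞) ≤ t) : Measurable fun ω => f (θ ω) ω := by
  refine measurable_of_Ioi fun a => ?_
  have lt_eval_iff : (fun ω => f (θ ω) ω) ⁻¹' Ioi a = ⋃ q : ℚ,
      {ω | Real.toNNReal q ≤ θ ω} ∩ f (stopTime t (Real.toNNReal q)) ⁻¹' Ioi a := by
    ext ω
    simp only [mem_preimage, mem_Ioi, mem_iUnion, mem_inter_iff, mem_ofPred_eq]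
    constructor
    · intro h
      rcases eq_zero_or_pos (θ ω) with hθ0 | hθ0
      · exact ⟨0, by simp, by simpa [hθ0, stopTime_zero] using h⟩
      obtain ⟨r, hr, hlt⟩ := (mem_nhdsLE_iff_exists_Ioc_subset' hθ0).1
        ((hf_left ω (θ ω)).eventually_const_lt h)
      obtain ⟨q, -, hrq, hqθ⟩ := (NNReal.lt_iff_exists_rat_btwn _ _).1 (mem_Iio.1 hr)
      refine ⟨q, hqθ.le, ?_⟩
      rw [stopTime_of_le ((ENNReal.coe_le_coe.2 hqθ.le).trans (hθt ω))]
      exact hlt ⟨hrq, hqθ.le⟩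
    · rintro ⟨q, hqθ, h⟩
      exact h.trans_le (hf_mono ω ((stopTime_le _ _).trans hqθ))
  rw [lt_eval_iff]
  exact MeasurableSet.iUnion fun q => (measurableSet_le measurable_const hθ).inter
    (hf _ (coe_stopTime_le _ _) measurableSet_Ioi)

end Sampling

theorem measurable_stopAfter {Ω : Type*} {m : MeasurableSpace Ω} {K : ℝ≥0 → Ω → ℝ}
    {T : Ω → ℝ≥0∞} {θ : Ω → ℝ≥0} {t : ℝ≥0∞}
    (hK : ∀ s : ℝ≥0, (s : ℝ≥0∞) ≤ t → Measurable (K s)) (hK_mono : ∀ ω, Monotone fun s => K s ω)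
    (hK_left : ∀ ω s, ContinuousWithinAt (fun s => K s ω) (Iic s) s)
    (hT : Measurable fun ω => stopTime (T ω) (θ ω)) (hθ : Measurable θ)
    (hθt : ∀ ω, (θ ω : ℝ≥0∞) ≤ t) :
    Measurable fun ω => stopAfter (fun s => K s ω) (T ω) (θ ω) := by
  refine measurable_of_tendsto_metrizable
    (f := fun (n : ℕ) ω => K (min (stopTime (T ω) (θ ω) + 1 / ((n : ℝ≥0) + 1)) (θ ω)) ω)
    (fun n => measurable_eval_of_leftContinuous hK hK_mono hK_left
      ((hT.add_const _).min hθ)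
      fun ω => (ENNReal.coe_le_coe.2 (min_le_right _ _)).trans (hθt ω))
    (tendsto_pi_nhds.2 fun ω => tendsto_stopAfter (hK_mono ω) _ _ ?_)
  refine tendsto_nhdsWithin_iff.2 ⟨?_, Eventually.of_forall fun n => ?_⟩
  · simpa using (tendsto_const_nhds (x := stopTime (T ω) (θ ω))).add
      (tendsto_one_div_add_atTop_nhds_zero_nat (𝕜 := ℝ≥0))
  · exact lt_add_of_pos_right (stopTime (T ω) (θ ω)) (by positivity)

theorem measurable_rightLim {Ω : Type*} {m : MeasurableSpace Ω} {K : ℝ≥0 → Ω → ℝ} {s t : ℝ≥0}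
    (hK : ∀ r ≤ t, Measurable (K r)) (hK_mono : ∀ ω, Monotone fun r => K r ω)
    (hK_left : ∀ ω r, ContinuousWithinAt (fun r => K r ω) (Iic r) r) (hst : s < t) :
    Measurable fun ω => Function.rightLim (fun r => K r ω) s := by
  have h := measurable_stopAfter (T := fun _ => s) (θ := fun _ => t) (t := t)
    (fun r hr => hK r (ENNReal.coe_le_coe.1 hr)) hK_mono hK_left
    measurable_const measurable_const fun _ => le_rfl
  simpa only [stopAfter_of_lt _ (ENNReal.coe_lt_coe.2 hst), ENNReal.toNNReal_coe] using h

section OptionalTime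

variable {Ω : Type*} {m : MeasurableSpace Ω} {𝔽 : Filtration ℝ≥0 m} {T : Ω → ℝ≥0∞}

/-- Optional times of a filtration: the random times `T` with `{T < t} ∈ 𝔽 t` for all `t`, encoded
by the equivalent condition that `t ∧ T` is `𝔽 t`-measurable. -/
def IsOptionalTime (𝔽 : Filtration ℝ≥0 m) (T : Ω → ℝ≥0∞) : Prop :=
  ∀ t : ℝ≥0, Measurable[𝔽 t] fun ω => stopTime (T ω) t

theorem isOptionalTime_of_measurableSet_lt
    (hT : ∀ t : ℝ≥0, MeasurableSet[𝔽 t] {ω | T ω < t}) : IsOptionalTime 𝔽 T := by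
  refine fun t => measurable_of_Iio fun a => ?_
  have stopTime_lt_iff (ω : Ω) : stopTime (T ω) t < a ↔ t < a ∨ T ω < a := by
    rw [← ENNReal.coe_lt_coe, coe_stopTime, min_lt_iff, ENNReal.coe_lt_coe]
  rcases lt_or_ge t a with hta | hat
  · have : (fun ω => stopTime (T ω) t) ⁻¹' Iio a = univ := by
      ext ω
      simp [stopTime_lt_iff, hta]
    rw [this]
    exact @MeasurableSet.univ _ (𝔽 t)
  · have : (fun ω => stopTime (T ω) t) ⁻¹' Iio a = {ω | T ω < a} := by
      ext ω
      simp [stopTime_lt_iff, hat.not_gt]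
    rw [this]
    exact 𝔽.mono hat _ (hT a)

theorem measurable_of_isOptionalTime (hT : IsOptionalTime 𝔽 T) : Measurable T := by
  have iSup_stopTime (ω : Ω) : T ω = ⨆ n : ℕ, (stopTime (T ω) n : ℝ≥0∞) := by
    simp only [coe_stopTime, ENNReal.coe_natCast, ← iSup_inf_eq, ENNReal.iSup_natCast, top_inf_eq]
  rw [funext iSup_stopTime]
  exact Measurable.iSup fun n => ((hT n).mono (𝔽.le _) le_rfl).coe_nnreal_ennreal

theorem measurableSet_le_of_isOptionalTime (hT : IsOptionalTime 𝔽 T) (t : ℝ≥0) :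
    MeasurableSet[𝔽 t] {ω | (t : ℝ≥0∞) ≤ T ω} := by
  have : {ω | (t : ℝ≥0∞) ≤ T ω} = (fun ω => stopTime (T ω) t) ⁻¹' Ici t := by
    ext ω
    rw [mem_preimage, mem_Ici, ← ENNReal.coe_le_coe, coe_stopTime]
    simp
  rw [this]
  exact hT t measurableSet_Ici

theorem measurable_of_adapted_of_le {β : Type*} [MeasurableSpace β] {f : ℝ≥0 → Ω → β}
    (hf : Adapted 𝔽 f) {s t : ℝ≥0} (hst : (s : ℝ≥0∞) ≤ t) : Measurable[𝔽 t] (f s) :=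
  (hf s).mono (𝔽.mono (ENNReal.coe_le_coe.1 hst)) le_rfl

section Adapted

variable {β : Type*} [LinearOrder β] [TopologicalSpace β] [OrderTopology β]
  [SecondCountableTopology β] [MeasurableSpace β] [BorelSpace β] {f : ℝ≥0 → Ω → β}

theorem adapted_comp_stopTime_of_rightContinuous (hf : Adapted 𝔽 f)
    (hf_mono : ∀ ω, Monotone fun s => f s ω)
    (hf_right : ∀ ω s, ContinuousWithinAt (fun s => f s ω) (Ici s) s)
    (hT : IsOptionalTime 𝔽 T) : Adapted 𝔽 fun t ω => f (stopTime (T ω) t) ω := fun t =>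
  measurable_eval_of_rightContinuous (t := t) (fun _ hs => measurable_of_adapted_of_le hf hs)
    hf_mono hf_right (hT t) fun _ => ENNReal.coe_le_coe.2 (stopTime_le _ _)

theorem adapted_comp_stopTime_of_leftContinuous (hf : Adapted 𝔽 f)
    (hf_mono : ∀ ω, Monotone fun s => f s ω)
    (hf_left : ∀ ω s, ContinuousWithinAt (fun s => f s ω) (Iic s) s)
    (hT : IsOptionalTime 𝔽 T) : Adapted 𝔽 fun t ω => f (stopTime (T ω) t) ω := fun t =>
  measurable_eval_of_leftContinuous (t := t) (fun _ hs => measurable_of_adapted_of_le hf hs)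
    hf_mono hf_left (hT t) fun _ => ENNReal.coe_le_coe.2 (stopTime_le _ _)

end Adapted

end OptionalTime

section FirstPassage

variable {β : Type*} [LinearOrder β]

/-- The first time at which a path reaches the level `c`, infinite if there is none. -/
noncomputable def firstPassage (g : ℝ≥0 → β) (c : β) : ℝ≥0∞ := sInf ((↑) '' {t | c ≤ g t})

variable [TopologicalSpace β] [OrderTopology β]

theorem firstPassage_le_iff {g : ℝ≥0 → β} (hg : Monotone g)
    (hg_right : ∀ t, ContinuousWithinAt g (Ici t) t) {c : β} {t : ℝ≥0} :
    firstPassage g c ≤ t ↔ c ≤ g t := by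
  refine ⟨fun h => ?_, fun h => sInf_le (mem_image_of_mem _ h)⟩
  by_contra! hlt
  obtain ⟨r, htr, hr⟩ := mem_nhdsGE_iff_exists_Ico_subset.1 ((hg_right t).eventually_lt_const hlt)
  have not_before : (r : ℝ≥0∞) ≤ firstPassage g c := by
    refine le_sInf (forall_mem_image.2 fun s hs => ENNReal.coe_le_coe.2 ?_)
    by_contra! hsr
    rcases le_total s t with hst | hts
    · exact ((hg hst).trans_lt hlt).not_ge hs
    · exact (hr ⟨hts, hsr⟩ : g s < c).not_ge hs
  exact (ENNReal.coe_le_coe.1 (not_before.trans h)).not_gt htr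

theorem isOptionalTime_firstPassage [SecondCountableTopology β] [MeasurableSpace β] [BorelSpace β]
    {Ω : Type*} {m : MeasurableSpace Ω} {𝔽 : Filtration ℝ≥0 m} {f : ℝ≥0 → Ω → β}
    (hf : Adapted 𝔽 f) (hf_mono : ∀ ω, Monotone fun s => f s ω)
    (hf_right : ∀ ω s, ContinuousWithinAt (fun s => f s ω) (Ici s) s) (c : β) :
    IsOptionalTime 𝔽 fun ω => firstPassage (fun s => f s ω) c := by
  refine isOptionalTime_of_measurableSet_lt fun t => ?_
  have lt_iff : {ω | firstPassage (fun s => f s ω) c < t} =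
      ⋃ (q : ℚ) (_ : Real.toNNReal q < t), f (Real.toNNReal q) ⁻¹' Ici c := by
    ext ω
    simp only [mem_ofPred_eq, mem_iUnion, mem_preimage, mem_Ici, exists_prop,
      ← firstPassage_le_iff (hf_mono ω) (hf_right ω)]
    refine ⟨fun h => ?_, fun ⟨q, hqt, hq⟩ => hq.trans_lt (ENNReal.coe_lt_coe.2 hqt)⟩
    obtain ⟨q, -, hq, hqt⟩ := ENNReal.lt_iff_exists_rat_btwn.1 h
    exact ⟨q, ENNReal.coe_lt_coe.1 hqt, hq.le⟩
  rw [lt_iff]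
  exact MeasurableSet.iUnion fun q => MeasurableSet.iUnion fun hq =>
    𝔽.mono hq.le _ (hf _ measurableSet_Ici)

end FirstPassage

/-! ### Running maxima -/

/-- The running maximum `sup_{s ≤ t} (Z_s - k_s)⁺`. -/
noncomputable def runMax (Z k : ℝ≥0 → ℝ) (t : ℝ≥0) : ℝ :=
  sSup ((fun s => max 0 (Z s - k s)) '' Iic t)

section RunMax

variable {Z k : ℝ≥0 → ℝ}

theorem runMax_le {t : ℝ≥0} {a : ℝ} (ha : 0 ≤ a) (h : ∀ s ≤ t, Z s - k s ≤ a) :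
    runMax Z k t ≤ a :=
  csSup_le (nonempty_Iic.image _) (forall_mem_image.2 fun s hs => max_le ha (h s hs))

variable (hZ : Monotone Z) (hk : Monotone k)

include hZ hk

theorem max_le_runMax {s t : ℝ≥0} (h : s ≤ t) : max 0 (Z s - k s) ≤ runMax Z k t := by
  refine le_csSup ⟨max 0 (Z t - k 0), forall_mem_image.2 fun s hs => ?_⟩ (mem_image_of_mem _ h)
  exact max_le_max le_rfl (sub_le_sub (hZ hs) (hk zero_le))

theorem le_runMax {s t : ℝ≥0} (h : s ≤ t) : Z s - k s ≤ runMax Z k t :=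
  (le_max_right _ _).trans (max_le_runMax hZ hk h)

theorem runMax_nonneg (t : ℝ≥0) : 0 ≤ runMax Z k t :=
  (le_max_left _ _).trans (max_le_runMax hZ hk le_rfl)

theorem lt_runMax_iff {t : ℝ≥0} {a : ℝ} (ha : 0 ≤ a) :
    a < runMax Z k t ↔ ∃ s ≤ t, a < Z s - k s := by
  refine ⟨fun h => ?_, fun ⟨s, hs, h⟩ => h.trans_le (le_runMax hZ hk hs)⟩
  by_contra! hle
  exact h.not_ge (runMax_le ha hle)

theorem monotone_runMax : Monotone (runMax Z k) := fun _ t hst =>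
  runMax_le (runMax_nonneg hZ hk t) fun _ hr => le_runMax hZ hk (hr.trans hst)

theorem runMax_rightContinuous (hZ_right : ∀ t, ContinuousWithinAt Z (Ici t) t) (t : ℝ≥0) :
    ContinuousWithinAt (runMax Z k) (Ici t) t := by
  refine tendsto_order.2 ⟨fun a ha => ?_, fun a ha => ?_⟩
  · filter_upwards [self_mem_nhdsWithin] with s hs using ha.trans_le (monotone_runMax hZ hk hs)
  · obtain ⟨b, hb, hba⟩ := exists_between ha
    filter_upwards [(hZ_right t).eventually_lt_const (lt_add_of_pos_right (Z t) (sub_pos.2 hb))]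
      with s hs
    refine lt_of_le_of_lt (runMax_le ((runMax_nonneg hZ hk t).trans hb.le) fun r hr => ?_) hba
    rcases le_total r t with hrt | htr
    · exact (le_runMax hZ hk hrt).trans hb.le
    · linarith [le_runMax hZ hk (le_refl t), hZ hr, hk htr]

end RunMax

section AdaptedRunMax

variable {Ω : Type*} {m : MeasurableSpace Ω} {𝔽 : Filtration ℝ≥0 m} {Z k : ℝ≥0 → Ω → ℝ}
  (hZ_mono : ∀ ω, Monotone fun s => Z s ω)
  (hZ_right : ∀ ω t, ContinuousWithinAt (fun s => Z s ω) (Ici t) t)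
  (hk_mono : ∀ ω, Monotone fun s => k s ω)

include hZ_mono hZ_right hk_mono

-- As `k` is non-decreasing, `Z - k` is largest when `Z` first reaches a given level, and countably
-- many levels suffice.
theorem lt_runMax_iff_exists_rat {ω : Ω} {t : ℝ≥0} {a : ℝ} (ha : 0 ≤ a) :
    a < runMax (fun s => Z s ω) (fun s => k s ω) t ↔ ∃ c : ℚ, (c : ℝ) ≤ Z t ω ∧
      k (stopTime (firstPassage (fun s => Z s ω) (c : ℝ)) t) ω < c - a := by
  have passage_le_iff {c : ℝ} {s : ℝ≥0} : firstPassage (fun s => Z s ω) c ≤ s ↔ c ≤ Z s ω :=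
    firstPassage_le_iff (hZ_mono ω) (hZ_right ω)
  rw [lt_runMax_iff (hZ_mono ω) (hk_mono ω) ha]
  constructor
  · rintro ⟨s, hst, hs⟩
    obtain ⟨c, hc, hcZ⟩ := exists_rat_btwn (lt_sub_iff_add_lt.1 hs)
    refine ⟨c, hcZ.le.trans (hZ_mono ω hst), ?_⟩
    have passage_le : stopTime (firstPassage (fun s => Z s ω) (c : ℝ)) t ≤ s :=
      ENNReal.coe_le_coe.1 ((coe_stopTime_le _ _).trans (passage_le_iff.2 hcZ.le))
    linarith [hk_mono ω passage_le]
  · rintro ⟨c, hc, hlt⟩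
    refine ⟨stopTime (firstPassage (fun s => Z s ω) (c : ℝ)) t, stopTime_le _ _, ?_⟩
    have reached : (c : ℝ) ≤ Z (stopTime (firstPassage (fun s => Z s ω) (c : ℝ)) t) ω := by
      rw [← passage_le_iff, coe_stopTime, min_eq_right (passage_le_iff.2 hc)]
    linarith

theorem adapted_runMax (hk_left : ∀ ω t, ContinuousWithinAt (fun s => k s ω) (Iic t) t)
    (hZ : Adapted 𝔽 Z) (hk : Adapted 𝔽 k) :
    Adapted 𝔽 fun t ω => runMax (fun s => Z s ω) (fun s => k s ω) t := by
  refine fun t => measurable_of_Ioi fun a => ?_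
  rcases lt_or_ge a 0 with ha | ha
  · have : (fun ω => runMax (fun s => Z s ω) (fun s => k s ω) t) ⁻¹' Ioi a = univ :=
      eq_univ_of_forall fun ω => ha.trans_le (runMax_nonneg (hZ_mono ω) (hk_mono ω) t)
    rw [this]
    exact @MeasurableSet.univ _ (𝔽 t)
  · have lt_iff : (fun ω => runMax (fun s => Z s ω) (fun s => k s ω) t) ⁻¹' Ioi a =
        ⋃ c : ℚ, Z t ⁻¹' Ici (c : ℝ) ∩
          (fun ω => k (stopTime (firstPassage (fun s => Z s ω) (c : ℝ)) t) ω) ⁻¹' Iio (c - a) := by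
      ext ω
      simpa using lt_runMax_iff_exists_rat hZ_mono hZ_right hk_mono ha
    rw [lt_iff]
    exact MeasurableSet.iUnion fun c => (hZ t measurableSet_Ici).inter
      (adapted_comp_stopTime_of_leftContinuous hk hk_mono hk_left
        (isOptionalTime_firstPassage hZ hZ_mono hZ_right c) t measurableSet_Iio)

end AdaptedRunMax

/-! ### Deferring injections along a path -/

theorem monotone_sub_comp_stopTime {g : ℝ≥0 → ℝ} (hg : Monotone g) (T : ℝ≥0∞) :
    Monotone fun t => g t - g (stopTime T t) := fun s t hst => by
  rcases le_total (s : ℝ≥0∞) T with hs | hs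
  · simpa [stopTime_of_le hs] using hg (stopTime_le T t)
  · simpa [stopTime_of_ge hs, stopTime_of_ge (hs.trans (ENNReal.coe_le_coe.2 hst))] using hg hst

theorem eventually_lt_coe_nhds {T : ℝ≥0∞} {t : ℝ≥0} (h : T < t) :
    ∀ᶠ s : ℝ≥0 in 𝓝 t, T < s :=
  (isOpen_lt continuous_const ENNReal.continuous_coe).mem_nhds h

/-- The part of the dividends `Z` that is withheld to make up for injections `k` that are not made:
what remains is the running maximum of `Z - k`, the largest payout that `Z` still allows. -/
noncomputable def withheld (Z k : ℝ≥0 → ℝ) (t : ℝ≥0) : ℝ := Z t - runMax Z k t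

/-- The dividends when those making up for the injections `k` are withheld up to time `σ`. -/
noncomputable def deferredZ (Z k : ℝ≥0 → ℝ) (σ : ℝ≥0∞) (t : ℝ≥0) : ℝ :=
  Z t - withheld Z k (stopTime σ t)

/-- The injections when the part `k` of `K` is deferred up to time `σ` and, immediately afterwards,
whatever part of it has not been made up for by withheld dividends is injected. The initial
value `k 0` is an amount that is deferred from before time `0`. -/
noncomputable def deferredK (Z K k : ℝ≥0 → ℝ) (σ : ℝ≥0∞) (t : ℝ≥0) : ℝ :=
  K t + k 0 - if (t : ℝ≥0∞) ≤ σ then k t else withheld Z k (stopTime σ t)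

section Deferred

variable {Z K k : ℝ≥0 → ℝ} {σ : ℝ≥0∞}

theorem withheld_nonneg (hZ : Monotone Z) (hZ0 : 0 ≤ Z 0) (hk0 : ∀ t, 0 ≤ k t) (t : ℝ≥0) :
    0 ≤ withheld Z k t :=
  sub_nonneg.2 (runMax_le (hZ0.trans (hZ zero_le)) fun s hs => by linarith [hZ hs, hk0 s])

theorem withheld_le (hZ : Monotone Z) (hk : Monotone k) (t : ℝ≥0) : withheld Z k t ≤ k t := by
  unfold withheld
  linarith [le_runMax hZ hk (le_refl t)]

theorem deferredZ_of_le {t : ℝ≥0} (h : (t : ℝ≥0∞) ≤ σ) : deferredZ Z k σ t = runMax Z k t := by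
  rw [deferredZ, stopTime_of_le h, withheld, sub_sub_cancel]

theorem deferredK_of_le {t : ℝ≥0} (h : (t : ℝ≥0∞) ≤ σ) : deferredK Z K k σ t = K t + k 0 - k t := by
  rw [deferredK, if_pos h]

theorem deferredK_of_lt {t : ℝ≥0} (h : σ < t) :
    deferredK Z K k σ t = K t + k 0 - withheld Z k (stopTime σ t) := by
  rw [deferredK, if_neg h.not_ge]

theorem monotone_deferredZ (hZ : Monotone Z) (hk : Monotone k) : Monotone (deferredZ Z k σ) := by
  intro s t hst
  have increment_le : Z s - Z (stopTime σ s) ≤ Z t - Z (stopTime σ t) :=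
    monotone_sub_comp_stopTime hZ σ hst
  unfold deferredZ withheld
  linarith [monotone_runMax hZ hk (stopTime_mono σ hst)]

theorem deferredZ_rightContinuous (hZ : Monotone Z) (hk : Monotone k)
    (hZ_right : ∀ t, ContinuousWithinAt Z (Ici t) t) (t : ℝ≥0) :
    ContinuousWithinAt (deferredZ Z k σ) (Ici t) t :=
  (hZ_right t).sub (continuousWithinAt_comp_stopTime_Ici
    (fun s => (hZ_right s).sub (runMax_rightContinuous hZ hk hZ_right s)) σ t)

theorem deferredZ_zero_nonneg (hZ : Monotone Z) (hk : Monotone k) : 0 ≤ deferredZ Z k σ 0 := by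
  rw [deferredZ_of_le (by simp)]
  exact runMax_nonneg hZ hk 0

theorem deferredK_le (hZ : Monotone Z) (hZ0 : 0 ≤ Z 0) (hk0 : ∀ t, 0 ≤ k t) (t : ℝ≥0) :
    deferredK Z K k σ t ≤ K t + k 0 := by
  unfold deferredK
  split_ifs
  · exact sub_le_self _ (hk0 t)
  · exact sub_le_self _ (withheld_nonneg hZ hZ0 hk0 _)

theorem monotone_deferredK (hZ : Monotone Z) (hk : Monotone k) (hK : Monotone K)
    (hKk : Monotone fun t => K t - k t) : Monotone (deferredK Z K k σ) := by
  intro s t hst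
  rcases le_or_gt (t : ℝ≥0∞) σ with ht | ht
  · have deferral_le : K s - k s ≤ K t - k t := hKk hst
    rw [deferredK_of_le ht, deferredK_of_le ((ENNReal.coe_le_coe.2 hst).trans ht)]
    linarith
  rcases le_or_gt (s : ℝ≥0∞) σ with hs | hs
  · have deferral_le : K s - k s ≤ K (stopTime σ t) - k (stopTime σ t) := hKk (le_stopTime hst hs)
    rw [deferredK_of_lt ht, deferredK_of_le hs]
    linarith [withheld_le hZ hk (stopTime σ t), hK (stopTime_le σ t)]
  · rw [deferredK_of_lt ht, deferredK_of_lt hs, stopTime_of_ge hs.le, stopTime_of_ge ht.le]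
    linarith [hK hst]

theorem deferredK_leftContinuous (hK_left : ∀ t, ContinuousWithinAt K (Iic t) t)
    (hk_left : ∀ t, ContinuousWithinAt k (Iic t) t) (t : ℝ≥0) :
    ContinuousWithinAt (deferredK Z K k σ) (Iic t) t := by
  rcases le_or_gt (t : ℝ≥0∞) σ with ht | ht
  · exact (((hK_left t).add continuousWithinAt_const).sub (hk_left t)).congr
      (fun s hs => deferredK_of_le ((ENNReal.coe_le_coe.2 hs).trans ht)) (deferredK_of_le ht)
  · have left_cont : ContinuousWithinAt
        (fun s => K s + k 0 - withheld Z k (stopTime σ t)) (Iic t) t :=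
      ((hK_left t).add continuousWithinAt_const).sub continuousWithinAt_const
    refine left_cont.congr_of_eventuallyEq ?_ (deferredK_of_lt ht)
    filter_upwards [mem_nhdsWithin_of_mem_nhds (eventually_lt_coe_nhds ht)] with s hs
    rw [deferredK_of_lt hs, stopTime_of_ge (le_of_lt hs), stopTime_of_ge ht.le]

theorem add_mul_deferredK_le (hZ : Monotone Z) (hk : Monotone k) {δ : ℝ} (hδ : 1 ≤ δ)
    (hZ0 : 0 ≤ Z 0) (hk0 : ∀ t, 0 ≤ k t) (t : ℝ≥0) :
    Z t + δ * deferredK Z K k σ t + (if (t : ℝ≥0∞) ≤ σ then (δ - 1) * k t else 0) ≤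
      deferredZ Z k σ t + δ * K t + δ * k 0 := by
  split_ifs with h
  · have withheld_le_k := withheld_le hZ hk t
    rw [deferredK_of_le h, deferredZ, stopTime_of_le h]
    linarith
  · have := mul_nonneg (sub_nonneg.2 hδ) (withheld_nonneg hZ hZ0 hk0 (stopTime σ t))
    rw [deferredK_of_lt (not_le.1 h), deferredZ]
    linarith

theorem runMax_le_max_prelimit (hZ : Monotone Z) (hk : Monotone k) (t : ℝ≥0) :
    runMax Z k t ≤ max (prelimit 0 (runMax Z k) t) (Z t - k t) := by
  rcases eq_or_ne t 0 with rfl | ht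
  · rw [prelimit_zero]
    exact runMax_le (le_max_left _ _) fun s hs => by
      rw [nonpos_iff_eq_zero.1 hs]
      exact le_max_right _ _
  · have runMax_le_prelimit {s : ℝ≥0} (hs : s < t) : runMax Z k s ≤ prelimit 0 (runMax Z k) t := by
      rw [prelimit, if_neg ht]
      exact (monotone_runMax hZ hk).le_leftLim hs
    refine runMax_le (le_max_of_le_left ((runMax_nonneg hZ hk 0).trans
      (runMax_le_prelimit (pos_iff_ne_zero.2 ht)))) fun s hs => ?_
    rcases hs.eq_or_lt with rfl | hs
    · exact le_max_right _ _
    · exact le_max_of_le_left ((le_runMax hZ hk le_rfl).trans (runMax_le_prelimit hs))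

theorem prelimit_sub_le_prelimit_runMax (hZ : Monotone Z) (hk : Monotone k) (hk0 : 0 ≤ k 0)
    (t : ℝ≥0) : prelimit 0 Z t - k t ≤ prelimit 0 (runMax Z k) t := by
  rcases eq_or_ne t 0 with rfl | ht
  · simpa [prelimit_zero] using hk0
  · have := neBot_nhdsLT ht
    refine le_of_tendsto_of_tendsto ((tendsto_prelimit hZ 0 ht).sub_const (k t))
      (tendsto_prelimit (monotone_runMax hZ hk) 0 ht) ?_
    filter_upwards [self_mem_nhdsWithin] with s hs
    linarith [le_runMax hZ hk (le_refl s), hk (le_of_lt hs)]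

theorem prelimit_deferredZ_of_le (hZ : Monotone Z) (hk : Monotone k) {t : ℝ≥0}
    (h : (t : ℝ≥0∞) ≤ σ) : prelimit 0 (deferredZ Z k σ) t = prelimit 0 (runMax Z k) t := by
  rcases eq_or_ne t 0 with rfl | ht
  · rw [prelimit_zero, prelimit_zero]
  · refine prelimit_eq_of_tendsto ht ((tendsto_prelimit (monotone_runMax hZ hk) 0 ht).congr' ?_)
    filter_upwards [self_mem_nhdsWithin] with s hs
    rw [deferredZ_of_le ((ENNReal.coe_le_coe.2 (le_of_lt hs)).trans h)]

theorem prelimit_deferredZ_of_lt (hZ : Monotone Z) {t : ℝ≥0} (h : σ < t) :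
    prelimit 0 (deferredZ Z k σ) t = prelimit 0 Z t - withheld Z k (stopTime σ t) := by
  have ht : t ≠ 0 := by
    rintro rfl
    simp at h
  refine prelimit_eq_of_tendsto ht (((tendsto_prelimit hZ 0 ht).sub_const _).congr' ?_)
  filter_upwards [mem_nhdsWithin_of_mem_nhds (eventually_lt_coe_nhds h)] with s hs
  rw [deferredZ, stopTime_of_ge (le_of_lt hs), stopTime_of_ge h.le]

theorem deferredZ_le_max (hZ : Monotone Z) (hk : Monotone k) (hk0 : 0 ≤ k 0) {r : ℝ} {t : ℝ≥0}
    (h : Z t ≤ max (prelimit 0 Z t) (r + K t)) :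
    deferredZ Z k σ t ≤
      max (prelimit 0 (deferredZ Z k σ) t) (r - k 0 + deferredK Z K k σ t) := by
  rcases le_or_gt (t : ℝ≥0∞) σ with ht | ht
  · rw [deferredK_of_le ht, deferredZ_of_le ht, prelimit_deferredZ_of_le hZ hk ht]
    refine (runMax_le_max_prelimit hZ hk t).trans (max_le (le_max_left _ _) ?_)
    rcases le_max_iff.1 h with no_lump | covered
    · exact le_max_of_le_left (by linarith [prelimit_sub_le_prelimit_runMax hZ hk hk0 t])
    · exact le_max_of_le_right (by linarith)
  · rw [prelimit_deferredZ_of_lt hZ ht, deferredK_of_lt ht, deferredZ]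
    rcases le_max_iff.1 h with no_lump | covered
    · exact le_max_of_le_left (by linarith)
    · exact le_max_of_le_right (by linarith)

end Deferred

/-- The injections made from time `τ` on, except for an initial amount `B`. -/
noncomputable def excessInjection (K : ℝ≥0 → ℝ) (τ : ℝ≥0∞) (B : ℝ) (t : ℝ≥0) : ℝ :=
  max 0 (K t - K (stopTime τ t) - B)

section Excess

variable {K : ℝ≥0 → ℝ} {τ : ℝ≥0∞} {B : ℝ}

theorem excessInjection_nonneg (t : ℝ≥0) : 0 ≤ excessInjection K τ B t := le_max_left _ _

theorem excessInjection_of_le (hB : 0 ≤ B) {t : ℝ≥0} (h : (t : ℝ≥0∞) ≤ τ) :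
    excessInjection K τ B t = 0 := by
  rw [excessInjection, stopTime_of_le h, sub_self, zero_sub]
  exact max_eq_left (neg_nonpos.2 hB)

theorem monotone_excessInjection (hK : Monotone K) : Monotone (excessInjection K τ B) :=
  fun _ _ hst => max_le_max_left _ (sub_le_sub_right (monotone_sub_comp_stopTime hK τ hst) B)

theorem sub_excessInjection (t : ℝ≥0) :
    K t - excessInjection K τ B t = min (K t) (K (stopTime τ t) + B) := by
  rw [excessInjection, ← min_sub_sub_left, sub_zero]
  congr 1
  ring

theorem monotone_sub_excessInjection (hK : Monotone K) :
    Monotone fun t => K t - excessInjection K τ B t := fun s t hst => by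
  simp only [sub_excessInjection]
  exact min_le_min (hK hst) (add_le_add_left (hK (stopTime_mono τ hst)) B)

theorem excessInjection_leftContinuous (hK_left : ∀ t, ContinuousWithinAt K (Iic t) t) (t : ℝ≥0) :
    ContinuousWithinAt (excessInjection K τ B) (Iic t) t :=
  continuousWithinAt_const.max
    (((hK_left t).sub (continuousWithinAt_comp_stopTime_Iic hK_left τ t)).sub
      continuousWithinAt_const)

end Excess

/-! ### Reserve, surplus and ruin -/

theorem RiskParams.c_mul_le_c_mul (p : RiskParams) {s t : ℝ≥0} (hst : s ≤ t) : p.c * s ≤ p.c * t :=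
  mul_le_mul_of_nonneg_left (NNReal.coe_le_coe.2 hst) p.c_pos.le

namespace HawkesClaims

variable {p : RiskParams} {y : ℝ} {Ω : Type*} [m : MeasurableSpace Ω] {P : Measure Ω}
  {𝔽 : Filtration ℝ≥0 m} (M : HawkesClaims p y P 𝔽)

/-- The aggregate claims up to time `t`. -/
noncomputable def claims (t : ℝ≥0) (ω : Ω) : ℝ := ∑ k ∈ Finset.range (M.N t ω), M.Y k ω

theorem reserve_eq (x : ℝ) (t : ℝ≥0) (ω : Ω) : M.reserve x t ω = x + p.c * t - M.claims t ω := rfl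

theorem claims_nonneg (t : ℝ≥0) (ω : Ω) : 0 ≤ M.claims t ω :=
  Finset.sum_nonneg fun k _ => (M.Y_pos k ω).le

theorem monotone_claims (ω : Ω) : Monotone fun t => M.claims t ω := fun _ _ h =>
  Finset.sum_le_sum_of_subset_of_nonneg (Finset.range_mono (M.N_mono ω h))
    fun k _ _ => (M.Y_pos k ω).le

theorem claims_rightContinuous (ω : Ω) (t : ℝ≥0) :
    ContinuousWithinAt (fun s => M.claims s ω) (Ici t) t :=
  ContinuousAt.comp_continuousWithinAt
    (g := fun n => ∑ k ∈ Finset.range n, M.Y k ω) continuous_of_discreteTopology.continuousAt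
    (M.N_rightContinuous ω t)

theorem reserve_rightContinuous (x : ℝ) (ω : Ω) (t : ℝ≥0) :
    ContinuousWithinAt (fun s => M.reserve x s ω) (Ici t) t :=
  (continuous_const.add (continuous_const.mul NNReal.continuous_coe)).continuousWithinAt.sub
    (M.claims_rightContinuous ω t)

theorem adapted_reserve (x : ℝ) : Adapted 𝔽 (M.reserve x) := fun t =>
  (measurable_const (a := x + p.c * t)).sub (M.claims_adapted t)

theorem reserve_le (x : ℝ) (t : ℝ≥0) (ω : Ω) : M.reserve x t ω ≤ x + p.c * t :=
  sub_le_self _ (M.claims_nonneg t ω)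

theorem reserve_le_reserve_of_N_eq (x : ℝ) {s t : ℝ≥0} {ω : Ω} (hst : s ≤ t)
    (h : M.N s ω = M.N t ω) : M.reserve x s ω ≤ M.reserve x t ω := by
  rw [reserve_eq, reserve_eq, claims, claims, h]
  linarith [p.c_mul_le_c_mul hst]

theorem reserve_of_N_eq_zero (x : ℝ) {t : ℝ≥0} {ω : Ω} (h : M.N t ω = 0) :
    M.reserve x t ω = x + p.c * t := by
  simp [reserve, h]

theorem reserve_sub (x r : ℝ) (t : ℝ≥0) (ω : Ω) :
    M.reserve (x - r) t ω = M.reserve x t ω - r := by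
  rw [reserve_eq, reserve_eq]
  ring

/-- The time of the `n`-th claim, with the `0`-th claim at time `0`. -/
noncomputable def claimTime (n : ℕ) (ω : Ω) : ℝ≥0∞ := firstPassage (fun t => M.N t ω) n

theorem claimTime_le_iff {n : ℕ} {ω : Ω} {t : ℝ≥0} : M.claimTime n ω ≤ t ↔ n ≤ M.N t ω :=
  firstPassage_le_iff (M.N_mono ω) (M.N_rightContinuous ω)

theorem lt_claimTime_iff {n : ℕ} {ω : Ω} {t : ℝ≥0} : t < M.claimTime n ω ↔ M.N t ω < n := by
  rw [← not_le, claimTime_le_iff, not_le]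

theorem claimTime_one_pos (ω : Ω) : 0 < M.claimTime 1 ω :=
  M.lt_claimTime_iff (t := 0).2 (by rw [M.N_zero]; exact one_pos)

theorem isOptionalTime_claimTime (n : ℕ) : IsOptionalTime 𝔽 (M.claimTime n) :=
  isOptionalTime_firstPassage M.N_adapted M.N_mono M.N_rightContinuous n

variable {x : ℝ} {α : Strategy Ω} {ω : Ω}

theorem surplusAfter_eq (x : ℝ) (α : Strategy Ω) (t : ℝ≥0) (ω : Ω) :
    M.surplusAfter x α t ω =
      M.reserve x t ω - α.Z t ω + Function.rightLim (fun s => α.K s ω) t :=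
  rightLim_eq_of_tendsto ((((M.reserve_rightContinuous x ω t).mono Ioi_subset_Ici_self).sub
    ((α.Z_rightContinuous ω t).mono Ioi_subset_Ici_self)).tendsto.add
      ((α.K_mono ω).tendsto_rightLim t))

theorem surplusAfter_rightContinuous (x : ℝ) (α : Strategy Ω) (ω : Ω) (t : ℝ≥0) :
    ContinuousWithinAt (fun s => M.surplusAfter x α s ω) (Ici t) t := by
  simp only [surplusAfter_eq]
  exact ((M.reserve_rightContinuous x ω t).sub (α.Z_rightContinuous ω t)).add
    ((α.K_mono ω).stieltjesFunction.right_continuous t)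

theorem prelimit_reserve (t : ℝ≥0) (ω : Ω) : prelimit 0 (fun s => M.reserve 0 s ω) t =
    p.c * t - prelimit 0 (fun s => M.claims s ω) t := by
  rcases eq_or_ne t 0 with rfl | ht
  · simp [prelimit_zero]
  · refine prelimit_eq_of_tendsto ht (Tendsto.sub ?_ (tendsto_prelimit (M.monotone_claims ω) 0 ht))
    have premium_continuous : Continuous fun s : ℝ≥0 => (0 : ℝ) + p.c * s := by fun_prop
    simpa using (premium_continuous.tendsto t).mono_left (nhdsWithin_le_nhds (s := Iio t))

theorem prelimit_surplus (x : ℝ) (α : Strategy Ω) (t : ℝ≥0) (ω : Ω) :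
    prelimit x (fun s => M.surplus x α s ω) t =
      x + p.c * t - prelimit 0 (fun s => M.claims s ω) t - prelimit 0 (fun s => α.Z s ω) t
        + α.K t ω := by
  rcases eq_or_ne t 0 with rfl | ht
  · simp [prelimit_zero, α.K_zero]
  · refine prelimit_eq_of_tendsto ht (Tendsto.add (Tendsto.sub (Tendsto.sub ?_
      (tendsto_prelimit (M.monotone_claims ω) 0 ht)) (tendsto_prelimit (α.Z_mono ω) 0 ht))
      ((α.K_leftContinuous ω t).mono Iio_subset_Iic_self))
    have premium_continuous : Continuous fun s : ℝ≥0 => x + p.c * s := by fun_prop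
    exact (premium_continuous.tendsto t).mono_left nhdsWithin_le_nhds

-- Both sides say that a lump-sum dividend at time `t` leaves a nonnegative surplus, since
-- `X_{t-} + R⁰_t - R⁰_{t-} = R^x_t - Z_{t-} + K_t`.
theorem dividend_le_iff (x : ℝ) (α : Strategy Ω) (t : ℝ≥0) (ω : Ω) :
    α.Z t ω - prelimit 0 (fun s => α.Z s ω) t ≤
        max 0 (prelimit x (fun s => M.surplus x α s ω) t
          + M.reserve 0 t ω - prelimit 0 (fun s => M.reserve 0 s ω) t) ↔
      α.Z t ω ≤ max (prelimit 0 (fun s => α.Z s ω) t) (M.reserve x t ω + α.K t ω) := by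
  rw [prelimit_surplus, prelimit_reserve, sub_le_iff_le_add, ← max_add_add_right, reserve_eq,
    reserve_eq]
  ring_nf

variable {M} in
theorem IsAdmissible.dividend_le_max (h : M.IsAdmissible x α) (ω : Ω) (t : ℝ≥0) :
    α.Z t ω ≤ max (prelimit 0 (fun s => α.Z s ω) t) (M.reserve x t ω + α.K t ω) :=
  (M.dividend_le_iff x α t ω).1 (h.dividend_le ω t)

theorem surplusAfter_nonneg {t : ℝ≥0} (h : t < M.ruinTime x α ω) :
    0 ≤ M.surplusAfter x α t ω := by
  by_contra! ruined
  exact h.not_ge (sInf_le ⟨t, rfl, ruined⟩)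

theorem le_ruinTime {T : ℝ≥0∞} (h : ∀ t : ℝ≥0, t < T → 0 ≤ M.surplusAfter x α t ω) :
    T ≤ M.ruinTime x α ω := by
  refine le_sInf ?_
  rintro _ ⟨t, rfl, ruined⟩
  exact not_lt.1 fun before => (h t before).not_gt ruined

theorem Z_le_of_lt_ruinTime {s t : ℝ≥0} (h : s < M.ruinTime x α ω) (hst : s < t) :
    α.Z s ω ≤ M.reserve x s ω + α.K t ω := by
  have nonneg := M.surplusAfter_nonneg h
  rw [surplusAfter_eq] at nonneg
  linarith [(α.K_mono ω).rightLim_le hst]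

theorem surplus_nonneg_of_N_eq (hα : M.IsAdmissible x α) {r t : ℝ≥0}
    (ht : t ≤ M.ruinTime x α ω) (hrt : r < t) (hN : M.N r ω = M.N t ω) :
    0 ≤ M.surplus x α t ω := by
  have ht0 : t ≠ 0 := (zero_le.trans_lt hrt).ne'
  have := neBot_nhdsLT ht0
  have prelimit_le : prelimit 0 (fun s => α.Z s ω) t ≤ M.reserve x t ω + α.K t ω := by
    refine le_of_tendsto (tendsto_prelimit (α.Z_mono ω) 0 ht0) ?_
    filter_upwards [Ioo_mem_nhdsLT hrt] with s hs
    have N_eq : M.N s ω = M.N t ω :=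
      le_antisymm (M.N_mono ω hs.2.le) (hN ▸ M.N_mono ω hs.1.le)
    linarith [M.reserve_le_reserve_of_N_eq x hs.2.le N_eq,
      M.Z_le_of_lt_ruinTime ((ENNReal.coe_lt_coe.2 hs.2).trans_le ht) hs.2]
  have dividend_le := hα.dividend_le_max ω t
  rw [max_eq_right prelimit_le] at dividend_le
  unfold surplus
  linarith

theorem Z_le_of_le_ruinTime (hα : M.IsAdmissible x α) {t : ℝ≥0} (ht : t ≤ M.ruinTime x α ω) :
    α.Z t ω ≤ max 0 x + p.c * t + α.K t ω := by
  have premium_nonneg : 0 ≤ p.c * t := mul_nonneg p.c_pos.le t.2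
  have K_nonneg : 0 ≤ α.K t ω := (α.K_zero ω).ge.trans (α.K_mono ω zero_le)
  refine (hα.dividend_le_max ω t).trans (max_le ?_ ?_)
  · rcases eq_or_ne t 0 with rfl | ht0
    · rw [prelimit_zero]
      linarith [le_max_left 0 x]
    · have := neBot_nhdsLT ht0
      refine le_of_tendsto (tendsto_prelimit (α.Z_mono ω) 0 ht0) ?_
      filter_upwards [self_mem_nhdsWithin] with s hs
      linarith [M.Z_le_of_lt_ruinTime ((ENNReal.coe_lt_coe.2 hs).trans_le ht) hs,
        M.reserve_le x s ω, p.c_mul_le_c_mul (le_of_lt hs), le_max_right 0 x]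
  · linarith [M.reserve_le x t ω, le_max_right 0 x]

theorem ruinTime_lt_iff {t : ℝ≥0} : M.ruinTime x α ω < t ↔
    ∃ q : ℚ, Real.toNNReal q < t ∧ M.surplusAfter x α (Real.toNNReal q) ω < 0 := by
  refine ⟨fun h => ?_, fun ⟨q, hqt, ruined⟩ =>
    (sInf_le ⟨_, rfl, ruined⟩ : M.ruinTime x α ω ≤ _).trans_lt (ENNReal.coe_lt_coe.2 hqt)⟩
  obtain ⟨_, ⟨s, rfl, ruined⟩, hst⟩ := sInf_lt_iff.1 h
  obtain ⟨r, hr, still_ruined⟩ := mem_nhdsGE_iff_exists_Ico_subset.1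
    ((M.surplusAfter_rightContinuous x α ω s).eventually_lt_const ruined)
  obtain ⟨q, -, hsq, hq⟩ := (NNReal.lt_iff_exists_rat_btwn s (min r t)).1
    (lt_min hr (ENNReal.coe_lt_coe.1 hst))
  exact ⟨q, hq.trans_le (min_le_right _ _), still_ruined ⟨hsq.le, hq.trans_le (min_le_left _ _)⟩⟩

theorem isOptionalTime_ruinTime (hα : M.IsAdmissible x α) : IsOptionalTime 𝔽 (M.ruinTime x α) := by
  refine isOptionalTime_of_measurableSet_lt fun t => ?_
  simp only [ruinTime_lt_iff, ofPred_exists, ofPred_and]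
  refine MeasurableSet.iUnion fun q => ?_
  by_cases hqt : Real.toNNReal q < t
  · refine (MeasurableSet.const _).inter ?_
    have before_measurable : Measurable[𝔽 t] fun ω =>
        M.reserve x (Real.toNNReal q) ω - α.Z (Real.toNNReal q) ω :=
      ((M.adapted_reserve x _).mono (𝔽.mono hqt.le) le_rfl).sub
        ((hα.Z_adapted _).mono (𝔽.mono hqt.le) le_rfl)
    have after_measurable := before_measurable.add
      (measurable_rightLim (fun r hr => (hα.K_adapted r).mono (𝔽.mono hr) le_rfl)
        α.K_mono α.K_leftContinuous hqt)
    simp only [surplusAfter_eq]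
    exact after_measurable measurableSet_Iio
  · simp [hqt]

end HawkesClaims

namespace Strategy

variable {Ω : Type*}

theorem Z_nonneg (α : Strategy Ω) (t : ℝ≥0) (ω : Ω) : 0 ≤ α.Z t ω :=
  (α.Z_zero_nonneg ω).trans (α.Z_mono ω zero_le)

theorem K_nonneg (α : Strategy Ω) (t : ℝ≥0) (ω : Ω) : 0 ≤ α.K t ω :=
  (α.K_zero ω).ge.trans (α.K_mono ω zero_le)

/-- The strategy that follows `α` until time `T`, and does nothing from then on; a lump-sum
injection of `α` at time `T` is not made. -/
noncomputable def stopped (α : Strategy Ω) (T : Ω → ℝ≥0∞) : Strategy Ω where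
  Z t ω := α.Z (stopTime (T ω) t) ω
  K t ω := α.K (stopTime (T ω) t) ω
  Z_mono ω := (α.Z_mono ω).comp (stopTime_mono (T ω))
  Z_rightContinuous ω := continuousWithinAt_comp_stopTime_Ici (α.Z_rightContinuous ω) (T ω)
  Z_zero_nonneg ω := α.Z_nonneg _ ω
  K_mono ω := (α.K_mono ω).comp (stopTime_mono (T ω))
  K_leftContinuous ω := continuousWithinAt_comp_stopTime_Iic (α.K_leftContinuous ω) (T ω)
  K_zero ω := by rw [stopTime_zero, α.K_zero]

end Strategy

namespace HawkesClaims

variable {p : RiskParams} {y : ℝ} {Ω : Type*} [m : MeasurableSpace Ω] {P : Measure Ω}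
  {𝔽 : Filtration ℝ≥0 m} {M : HawkesClaims p y P 𝔽} {x : ℝ} {α : Strategy Ω} {T : Ω → ℝ≥0∞}

theorem IsAdmissible.stopped (hα : M.IsAdmissible x α) (hT : IsOptionalTime 𝔽 T) :
    M.IsAdmissible x (α.stopped T) where
  Z_adapted :=
    adapted_comp_stopTime_of_rightContinuous hα.Z_adapted α.Z_mono α.Z_rightContinuous hT
  K_adapted :=
    adapted_comp_stopTime_of_leftContinuous hα.K_adapted α.K_mono α.K_leftContinuous hT
  dividend_le ω t := by
    rw [dividend_le_iff]
    rcases le_or_gt (t : ℝ≥0∞) (T ω) with h | h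
    · simpa only [Strategy.stopped, stopTime_of_le h, prelimit_comp_stopTime (α.Z_mono ω) 0 h]
        using hα.dividend_le_max ω t
    · refine le_max_of_le_left (le_of_eq (prelimit_eq_of_tendsto ?_ ?_).symm)
      · rintro rfl
        simp at h
      · refine tendsto_const_nhds.congr' ?_
        filter_upwards [mem_nhdsWithin_of_mem_nhds (eventually_lt_coe_nhds h)] with s hs
        simp only [Strategy.stopped, stopTime_of_ge (le_of_lt hs), stopTime_of_ge h.le]

theorem surplusAfter_stopped {t : ℝ≥0} {ω : Ω} (h : t < T ω) :
    M.surplusAfter x (α.stopped T) t ω = M.surplusAfter x α t ω := by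
  have K_eq : Function.rightLim (fun s => (α.stopped T).K s ω) t =
      Function.rightLim (fun s => α.K s ω) t := by
    refine rightLim_eq_of_tendsto (((α.K_mono ω).tendsto_rightLim t).congr' ?_)
    filter_upwards [mem_nhdsWithin_of_mem_nhds
      ((isOpen_lt ENNReal.continuous_coe continuous_const).mem_nhds h)] with s hs
    simp only [Strategy.stopped, stopTime_of_le (le_of_lt hs)]
  rw [surplusAfter_eq, surplusAfter_eq, K_eq]
  simp only [Strategy.stopped, stopTime_of_le h.le]

end HawkesClaims

/-! ### Deferring injections in a strategy -/

/-- A way of deferring some of the injections of the strategy `α` started from `x`: an amount `r` of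
the initial capital and the part `k - r` of the injections of `α` are deferred, up to time `σ`.
By `solvent`, the dividends that are not withheld can be paid without them until `α` is ruined. -/
structure Deferral {p : RiskParams} {y : ℝ} {Ω : Type*} [m : MeasurableSpace Ω] {P : Measure Ω}
    {𝔽 : Filtration ℝ≥0 m} (M : HawkesClaims p y P 𝔽) (x r : ℝ) (α : Strategy Ω) where
  k : ℝ≥0 → Ω → ℝ
  σ : Ω → ℝ≥0∞
  r_nonneg : 0 ≤ r
  k_zero : ∀ ω, k 0 ω = r
  k_mono : ∀ ω, Monotone fun t => k t ω
  K_sub_k_mono : ∀ ω, Monotone fun t => α.K t ω - k t ω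
  k_leftContinuous : ∀ ω t, ContinuousWithinAt (fun s => k s ω) (Iic t) t
  k_adapted : Adapted 𝔽 k
  σ_optional : IsOptionalTime 𝔽 σ
  solvent : ∀ ω (s t : ℝ≥0), s < t → t ≤ σ ω → s < M.ruinTime x α ω →
    runMax (fun u => α.Z u ω) (fun u => k u ω) s ≤ M.reserve x s ω + (α.K t ω - k t ω)

namespace Deferral

variable {p : RiskParams} {y : ℝ} {Ω : Type*} [m : MeasurableSpace Ω] {P : Measure Ω}
  {𝔽 : Filtration ℝ≥0 m} {M : HawkesClaims p y P 𝔽} {x r : ℝ} {α : Strategy Ω}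
  (D : Deferral M x r α) {ω : Ω}

theorem k_nonneg (t : ℝ≥0) (ω : Ω) : 0 ≤ D.k t ω :=
  D.r_nonneg.trans ((D.k_zero ω).ge.trans (D.k_mono ω zero_le))

/-- The strategy with the injections `D.k` deferred, started from `x - r`. -/
noncomputable def strategy : Strategy Ω where
  Z t ω := deferredZ (fun s => α.Z s ω) (fun s => D.k s ω) (D.σ ω) t
  K t ω := deferredK (fun s => α.Z s ω) (fun s => α.K s ω) (fun s => D.k s ω) (D.σ ω) t
  Z_mono ω := monotone_deferredZ (α.Z_mono ω) (D.k_mono ω)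
  Z_rightContinuous ω :=
    deferredZ_rightContinuous (α.Z_mono ω) (D.k_mono ω) (α.Z_rightContinuous ω)
  Z_zero_nonneg ω := deferredZ_zero_nonneg (α.Z_mono ω) (D.k_mono ω)
  K_mono ω := monotone_deferredK (α.Z_mono ω) (D.k_mono ω) (α.K_mono ω) (D.K_sub_k_mono ω)
  K_leftContinuous ω := deferredK_leftContinuous (α.K_leftContinuous ω) (D.k_leftContinuous ω)
  K_zero ω := by rw [deferredK_of_le (by simp), α.K_zero, zero_add, sub_self]

theorem strategy_Z (t : ℝ≥0) (ω : Ω) : D.strategy.Z t ω =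
    deferredZ (fun s => α.Z s ω) (fun s => D.k s ω) (D.σ ω) t := rfl

theorem strategy_K (t : ℝ≥0) (ω : Ω) : D.strategy.K t ω =
    deferredK (fun s => α.Z s ω) (fun s => α.K s ω) (fun s => D.k s ω) (D.σ ω) t := rfl

theorem adapted_withheld (hα : M.IsAdmissible x α) : Adapted 𝔽 fun t ω =>
    withheld (fun s => α.Z s ω) (fun s => D.k s ω) (stopTime (D.σ ω) t) := fun t =>
  (adapted_comp_stopTime_of_rightContinuous hα.Z_adapted α.Z_mono α.Z_rightContinuous
    D.σ_optional t).sub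
  (adapted_comp_stopTime_of_rightContinuous
    (adapted_runMax α.Z_mono α.Z_rightContinuous D.k_mono D.k_leftContinuous hα.Z_adapted
      D.k_adapted)
    (fun ω => monotone_runMax (α.Z_mono ω) (D.k_mono ω))
    (fun ω => runMax_rightContinuous (α.Z_mono ω) (D.k_mono ω) (α.Z_rightContinuous ω))
    D.σ_optional t)

theorem isAdmissible_strategy (hα : M.IsAdmissible x α) :
    M.IsAdmissible (x - r) D.strategy where
  Z_adapted t := (hα.Z_adapted t).sub (D.adapted_withheld hα t)
  K_adapted t := ((hα.K_adapted t).add ((D.k_adapted 0).mono (𝔽.mono zero_le) le_rfl)).sub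
    (Measurable.ite (measurableSet_le_of_isOptionalTime D.σ_optional t) (D.k_adapted t)
      (D.adapted_withheld hα t))
  dividend_le ω t := by
    rw [HawkesClaims.dividend_le_iff, HawkesClaims.reserve_sub]
    have dividend_le := deferredZ_le_max (K := fun s => α.K s ω) (r := M.reserve x t ω) (t := t)
      (σ := D.σ ω) (α.Z_mono ω) (D.k_mono ω) (D.k_nonneg 0 ω) (hα.dividend_le_max ω t)
    rwa [D.k_zero] at dividend_le

theorem surplusAfter_strategy_of_le {t : ℝ≥0} (h : D.σ ω ≤ t) :
    M.surplusAfter (x - r) D.strategy t ω = M.surplusAfter x α t ω := by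
  have K_after : Function.rightLim (fun s => D.strategy.K s ω) t =
      Function.rightLim (fun s => α.K s ω) t +
        (r - withheld (fun s => α.Z s ω) (fun s => D.k s ω) (stopTime (D.σ ω) t)) := by
    refine rightLim_eq_of_tendsto ((((α.K_mono ω).tendsto_rightLim t).add_const _).congr' ?_)
    filter_upwards [self_mem_nhdsWithin] with s hs
    have hσs : D.σ ω < s := h.trans_lt (ENNReal.coe_lt_coe.2 hs)
    rw [strategy_K, deferredK_of_lt hσs, D.k_zero, stopTime_of_ge h, stopTime_of_ge hσs.le]
    ring
  rw [HawkesClaims.surplusAfter_eq, HawkesClaims.surplusAfter_eq, K_after, strategy_Z, deferredZ,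
    HawkesClaims.reserve_sub]
  ring

theorem surplusAfter_strategy_nonneg {t : ℝ≥0} (ht : t < M.ruinTime x α ω) :
    0 ≤ M.surplusAfter (x - r) D.strategy t ω := by
  rcases le_or_gt (D.σ ω) t with hσ | hσ
  · exact (M.surplusAfter_nonneg ht).trans_eq (D.surplusAfter_strategy_of_le hσ).symm
  rw [HawkesClaims.surplusAfter_eq, strategy_Z, deferredZ_of_le hσ.le, HawkesClaims.reserve_sub]
  refine ge_of_tendsto (((D.strategy.K_mono ω).tendsto_rightLim t).const_add _) ?_
  filter_upwards [self_mem_nhdsWithin, mem_nhdsWithin_of_mem_nhds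
    ((isOpen_lt ENNReal.continuous_coe continuous_const).mem_nhds hσ)] with s hts hsσ
  rw [strategy_K, deferredK_of_le (le_of_lt hsσ), D.k_zero]
  linarith [D.solvent ω t s hts (le_of_lt hsσ) ht]

end Deferral

namespace HawkesClaims

variable {p : RiskParams} {y : ℝ} {Ω : Type*} [m : MeasurableSpace Ω] {P : Measure Ω}
  {𝔽 : Filtration ℝ≥0 m} (M : HawkesClaims p y P 𝔽) {x : ℝ} {α : Strategy Ω} {ω : Ω}

/-- The deferral of an initial injection of size `κ` up to the first claim. -/
noncomputable def initialDeferral {κ : ℝ} (hx : 0 ≤ x) (hκ : 0 ≤ κ) (α : Strategy Ω) :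
    Deferral M (x + κ) κ α where
  k _ _ := κ
  σ := M.claimTime 1
  r_nonneg := hκ
  k_zero _ := rfl
  k_mono _ := monotone_const
  K_sub_k_mono ω := (α.K_mono ω).add_const (-κ)
  k_leftContinuous _ _ := continuousWithinAt_const
  k_adapted _ := measurable_const
  σ_optional := M.isOptionalTime_claimTime 1
  solvent ω s t hst htσ hsT := by
    have no_claim : M.N s ω = 0 := Nat.lt_one_iff.1
      (M.lt_claimTime_iff.1 ((ENNReal.coe_lt_coe.2 hst).trans_le htσ))
    refine runMax_le ?_ fun u hu => ?_
    · have premium_nonneg : 0 ≤ p.c * s := mul_nonneg p.c_pos.le s.2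
      rw [M.reserve_of_N_eq_zero _ no_claim]
      linarith [α.K_nonneg t ω]
    · linarith [α.Z_mono ω hu, M.Z_le_of_lt_ruinTime hsT hst]

/-- The shortfall `(-X)⁺` of the surplus at the `n`-th claim, before an injection made
then. -/
noncomputable def shortfall (x : ℝ) (α : Strategy Ω) (n : ℕ) (ω : Ω) : ℝ :=
  max 0 (-M.surplus x α (M.claimTime n ω).toNNReal ω)

/-- What `α` injects after the `n`-th claim in excess of the shortfall at that claim. -/
noncomputable def excess (x : ℝ) (α : Strategy Ω) (n : ℕ) (t : ℝ≥0) (ω : Ω) : ℝ :=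
  excessInjection (fun s => α.K s ω) (M.claimTime n ω) (M.shortfall x α n ω) t

theorem shortfall_nonneg (x : ℝ) (α : Strategy Ω) (n : ℕ) (ω : Ω) : 0 ≤ M.shortfall x α n ω :=
  le_max_left _ _

theorem excess_of_le (x : ℝ) (α : Strategy Ω) {n : ℕ} {t : ℝ≥0} (h : t ≤ M.claimTime n ω) :
    M.excess x α n t ω = 0 :=
  excessInjection_of_le (M.shortfall_nonneg x α n ω) h

theorem adapted_surplus_claimTime (hα : M.IsAdmissible x α) (n : ℕ) :
    Adapted 𝔽 fun t ω => M.surplus x α (stopTime (M.claimTime n ω) t) ω := fun t => by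
  have hτ := M.isOptionalTime_claimTime n
  have claims_measurable := adapted_comp_stopTime_of_rightContinuous M.claims_adapted
    M.monotone_claims M.claims_rightContinuous hτ t
  have Z_measurable := adapted_comp_stopTime_of_rightContinuous hα.Z_adapted α.Z_mono
    α.Z_rightContinuous hτ t
  have K_measurable := adapted_comp_stopTime_of_leftContinuous hα.K_adapted α.K_mono
    α.K_leftContinuous hτ t
  exact (((((hτ t).coe_nnreal_real.const_mul p.c).const_add x).sub claims_measurable).sub
    Z_measurable).add K_measurable

theorem adapted_excess (hα : M.IsAdmissible x α) (n : ℕ) : Adapted 𝔽 (M.excess x α n) := fun t => by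
  have eq_stopped : M.excess x α n t = fun ω =>
      max 0 (α.K t ω - α.K (stopTime (M.claimTime n ω) t) ω -
        max 0 (-M.surplus x α (stopTime (M.claimTime n ω) t) ω)) := by
    funext ω
    rcases le_or_gt (M.claimTime n ω) t with h | h
    · rw [excess, excessInjection, shortfall, stopTime_of_ge h]
    · rw [M.excess_of_le x α h.le, stopTime_of_le h.le, sub_self, zero_sub]
      exact (max_eq_left (neg_nonpos.2 (le_max_left _ _))).symm
  rw [eq_stopped]
  exact measurable_const.max (((hα.K_adapted t).sub
    (adapted_comp_stopTime_of_leftContinuous hα.K_adapted α.K_mono α.K_leftContinuous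
      (M.isOptionalTime_claimTime n) t)).sub
    (measurable_const.max (M.adapted_surplus_claimTime hα n t).neg))

theorem shortfall_le_of_lt_ruinTime {n : ℕ} {τ t : ℝ≥0} (hτ : M.claimTime n ω = τ)
    (hτT : τ < M.ruinTime x α ω) (hτt : τ < t) :
    M.shortfall x α n ω ≤ α.K t ω - α.K τ ω := by
  rw [shortfall, hτ, ENNReal.toNNReal_coe]
  refine max_le (sub_nonneg.2 (α.K_mono ω hτt.le)) ?_
  rw [surplus]
  linarith [M.Z_le_of_lt_ruinTime hτT hτt]

theorem Z_le_reserve_add_shortfall {n : ℕ} {τ : ℝ≥0} (hτ : M.claimTime n ω = τ) :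
    α.Z τ ω ≤ M.reserve x τ ω + (α.K τ ω + M.shortfall x α n ω) := by
  have neg_surplus_le : -M.surplus x α τ ω ≤ M.shortfall x α n ω := by
    rw [shortfall, hτ, ENNReal.toNNReal_coe]
    exact le_max_right _ _
  rw [surplus] at neg_surplus_le
  linarith

theorem sub_excess_of_lt {n : ℕ} {τ t : ℝ≥0} (hτ : M.claimTime n ω = τ)
    (hτT : τ < M.ruinTime x α ω) (hτt : τ < t) :
    α.K t ω - M.excess x α n t ω = α.K τ ω + M.shortfall x α n ω := by
  rw [excess, sub_excessInjection (K := fun s => α.K s ω), hτ, stopTime_coe, min_eq_right hτt.le]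
  exact min_eq_right (by linarith [M.shortfall_le_of_lt_ruinTime hτ hτT hτt])

-- Between two claims the reserve grows, so once the shortfall at the first of them has been
-- injected, the dividends up to it and the later dividends net of injections are covered.
theorem runMax_excess_le_of_le (hα : M.IsAdmissible x α) {n : ℕ} {τ s : ℝ≥0}
    (hτ : M.claimTime n ω = τ) (hτs : τ ≤ s) (hsσ : s < M.claimTime (n + 1) ω)
    (hsT : s < M.ruinTime x α ω) :
    runMax (fun u => α.Z u ω) (fun u => M.excess x α n u ω) s ≤
      M.reserve x s ω + (α.K τ ω + M.shortfall x α n ω) := by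
  have N_eq {u : ℝ≥0} (hτu : τ ≤ u) (hus : u ≤ s) : M.N u ω = n :=
    le_antisymm ((M.N_mono ω hus).trans (Nat.lt_succ_iff.1 (M.lt_claimTime_iff.1 hsσ)))
      ((M.claimTime_le_iff.1 hτ.le).trans (M.N_mono ω hτu))
  have reserve_le {u : ℝ≥0} (hτu : τ ≤ u) (hus : u ≤ s) : M.reserve x u ω ≤ M.reserve x s ω :=
    M.reserve_le_reserve_of_N_eq x hus ((N_eq hτu hus).trans (N_eq hτs le_rfl).symm)
  have Z_le := M.Z_le_reserve_add_shortfall (x := x) (α := α) hτ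
  refine runMax_le (by linarith [reserve_le le_rfl hτs, α.Z_nonneg τ ω]) fun u hus => ?_
  rcases le_or_gt u τ with huτ | hτu
  · rw [M.excess_of_le x α ((ENNReal.coe_le_coe.2 huτ).trans hτ.ge), sub_zero]
    linarith [α.Z_mono ω huτ, reserve_le le_rfl hτs]
  · have surplus_nonneg := M.surplus_nonneg_of_N_eq hα ((ENNReal.coe_le_coe.2 hus).trans hsT.le)
      hτu ((N_eq le_rfl hτs).trans (N_eq hτu.le hus).symm)
    have sub_excess := M.sub_excess_of_lt hτ ((ENNReal.coe_le_coe.2 hτs).trans_lt hsT) hτu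
    rw [surplus] at surplus_nonneg
    linarith [reserve_le hτu.le hus]

theorem runMax_excess_le (hα : M.IsAdmissible x α) {n : ℕ} {s t : ℝ≥0} (hst : s < t)
    (htσ : t ≤ M.claimTime (n + 1) ω) (hsT : s < M.ruinTime x α ω) :
    runMax (fun u => α.Z u ω) (fun u => M.excess x α n u ω) s ≤
      M.reserve x s ω + (α.K t ω - M.excess x α n t ω) := by
  rcases le_or_gt (M.claimTime n ω) s with hτs | hsτ
  · obtain ⟨τ, hτ, hτs⟩ := ENNReal.le_coe_iff.1 hτs
    rw [M.sub_excess_of_lt hτ ((ENNReal.coe_le_coe.2 hτs).trans_lt hsT) (hτs.trans_lt hst)]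
    exact M.runMax_excess_le_of_le hα hτ hτs ((ENNReal.coe_lt_coe.2 hst).trans_le htσ) hsT
  · obtain ⟨u, hsu, hu⟩ := exists_between (lt_min hsτ (ENNReal.coe_lt_coe.2 hst))
    lift u to ℝ≥0 using (hu.trans_le (min_le_right _ _)).ne_top
    rw [ENNReal.coe_lt_coe] at hsu
    have Z_le := M.Z_le_of_lt_ruinTime hsT hsu
    have sub_excess_le : α.K u ω - M.excess x α n u ω ≤ α.K t ω - M.excess x α n t ω :=
      monotone_sub_excessInjection (α.K_mono ω)
        (ENNReal.coe_le_coe.1 (hu.trans_le (min_le_right _ _)).le)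
    rw [M.excess_of_le x α (hu.trans_le (min_le_left _ _)).le, sub_zero] at sub_excess_le
    refine runMax_le (by linarith [α.Z_nonneg s ω]) fun v hvs => ?_
    have excess_nonneg : 0 ≤ M.excess x α n v ω := excessInjection_nonneg v
    linarith [α.Z_mono ω hvs]

/-- The deferral of the excess injections after the `n`-th claim up to the next claim. -/
noncomputable def excessDeferral (hα : M.IsAdmissible x α) (n : ℕ) : Deferral M x 0 α where
  k := M.excess x α n
  σ := M.claimTime (n + 1)
  r_nonneg := le_rfl
  k_zero _ := M.excess_of_le x α (by simp)
  k_mono ω := monotone_excessInjection (α.K_mono ω)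
  K_sub_k_mono ω := monotone_sub_excessInjection (α.K_mono ω)
  k_leftContinuous ω := excessInjection_leftContinuous (α.K_leftContinuous ω)
  k_adapted := M.adapted_excess hα n
  σ_optional := M.isOptionalTime_claimTime (n + 1)
  solvent _ _ _ hst htσ hsT := M.runMax_excess_le hα hst htσ hsT

end HawkesClaims

/-! ### The reward as an expectation -/

theorem measurable_stopTime {Ω : Type*} [MeasurableSpace Ω] {T : Ω → ℝ≥0∞} (hT : Measurable T) :
    Measurable fun z : Ω × ℝ≥0 => stopTime (T z.1) z.2 :=
  (measurable_snd.coe_nnreal_ennreal.min (hT.comp measurable_fst)).ennreal_toNNReal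

theorem measurable_eval_of_adapted_of_leftContinuous {Ω : Type*} {m : MeasurableSpace Ω}
    {𝔽 : Filtration ℝ≥0 m} {k : ℝ≥0 → Ω → ℝ} (hk : Adapted 𝔽 k)
    (hk_mono : ∀ ω, Monotone fun t => k t ω)
    (hk_left : ∀ ω t, ContinuousWithinAt (fun s => k s ω) (Iic t) t)
    {θ : Ω × ℝ≥0 → ℝ≥0} (hθ : Measurable θ) : Measurable fun z => k (θ z) z.1 :=
  measurable_eval_of_leftContinuous (t := ⊤) (f := fun s (z : Ω × ℝ≥0) => k s z.1)
    (fun s _ => ((hk s).mono (𝔽.le s) le_rfl).comp measurable_fst)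
    (fun z => hk_mono z.1) (fun z => hk_left z.1) hθ fun _ => le_top

namespace HawkesClaims

variable {p : RiskParams} {y : ℝ} {Ω : Type*} [m : MeasurableSpace Ω] {P : Measure Ω}
  {𝔽 : Filtration ℝ≥0 m} (M : HawkesClaims p y P 𝔽) {x : ℝ} {α : Strategy Ω}

/-- The dividends paid until the earlier of the times `z.2` and ruin. -/
noncomputable def paidDividends (x : ℝ) (α : Strategy Ω) (z : Ω × ℝ≥0) : ℝ :=
  α.Z (stopTime (M.ruinTime x α z.1) z.2) z.1

/-- The injections paid before time `z.2` and up to ruin, including a lump sum at ruin. -/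
noncomputable def paidInjections (x : ℝ) (α : Strategy Ω) (z : Ω × ℝ≥0) : ℝ :=
  stopAfter (fun s => α.K s z.1) (M.ruinTime x α z.1) z.2

/-- The dividends paid, net of the cost of the injections. Its expectation, with `z.2` an
independent exponential time of rate `ρ`, is the reward. -/
noncomputable def netPayout (x : ℝ) (α : Strategy Ω) (z : Ω × ℝ≥0) : ℝ :=
  M.paidDividends x α z - p.δ * M.paidInjections x α z

instance : IsProbabilityMeasure (discountMeasure p.ρ) :=
  isProbabilityMeasure_discountMeasure p.ρ_pos

theorem measurable_stopTime_ruinTime (hα : M.IsAdmissible x α) :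
    Measurable fun z : Ω × ℝ≥0 => stopTime (M.ruinTime x α z.1) z.2 :=
  measurable_stopTime (measurable_of_isOptionalTime (M.isOptionalTime_ruinTime hα))

theorem measurable_paidDividends (hα : M.IsAdmissible x α) :
    Measurable (M.paidDividends x α) :=
  measurable_eval_of_rightContinuous (t := ⊤) (f := fun s (z : Ω × ℝ≥0) => α.Z s z.1)
    (fun s _ => ((hα.Z_adapted s).mono (𝔽.le s) le_rfl).comp measurable_fst)
    (fun z => α.Z_mono z.1) (fun z => α.Z_rightContinuous z.1)
    (M.measurable_stopTime_ruinTime hα) fun _ => le_top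

theorem measurable_paidInjections (hα : M.IsAdmissible x α) :
    Measurable (M.paidInjections x α) :=
  measurable_stopAfter (t := ⊤) (K := fun s (z : Ω × ℝ≥0) => α.K s z.1)
    (fun s _ => ((hα.K_adapted s).mono (𝔽.le s) le_rfl).comp measurable_fst)
    (fun z => α.K_mono z.1) (fun z => α.K_leftContinuous z.1)
    (M.measurable_stopTime_ruinTime hα) measurable_snd fun _ => le_top

theorem paidDividends_nonneg (x : ℝ) (α : Strategy Ω) (z : Ω × ℝ≥0) :
    0 ≤ M.paidDividends x α z :=
  α.Z_nonneg _ _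

theorem le_paidInjections (x : ℝ) (α : Strategy Ω) (z : Ω × ℝ≥0) :
    α.K (stopTime (M.ruinTime x α z.1) z.2) z.1 ≤ M.paidInjections x α z :=
  le_stopAfter (α.K_mono z.1) _ _

theorem mul_paidInjections_sub_nonneg (x : ℝ) (α : Strategy Ω) (z : Ω × ℝ≥0) :
    0 ≤ p.δ * (M.paidInjections x α z - α.K (stopTime (M.ruinTime x α z.1) z.2) z.1) :=
  mul_nonneg (zero_le_one.trans p.one_lt_δ.le) (sub_nonneg.2 (M.le_paidInjections x α z))

theorem paidInjections_nonneg (x : ℝ) (α : Strategy Ω) (z : Ω × ℝ≥0) :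
    0 ≤ M.paidInjections x α z :=
  (α.K_nonneg _ _).trans (M.le_paidInjections x α z)

theorem paidDividends_le (hα : M.IsAdmissible x α) (z : Ω × ℝ≥0) :
    M.paidDividends x α z ≤ max 0 x + p.c * z.2 + M.paidInjections x α z := by
  have Z_le := M.Z_le_of_le_ruinTime hα (coe_stopTime_le (M.ruinTime x α z.1) z.2)
  have premium_le := p.c_mul_le_c_mul (stopTime_le (M.ruinTime x α z.1) z.2)
  have K_le := M.le_paidInjections x α z
  unfold paidDividends
  linarith

theorem netPayout_le (hα : M.IsAdmissible x α) (z : Ω × ℝ≥0) :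
    M.netPayout x α z ≤ max 0 x + p.c * z.2 := by
  have cost_nonneg := mul_nonneg (sub_nonneg.2 p.one_lt_δ.le) (M.paidInjections_nonneg x α z)
  unfold netPayout
  linarith [M.paidDividends_le hα z]

theorem expectedDividends_eq (hα : M.IsAdmissible x α) : M.expectedDividends x α =
    ∫⁻ z, ENNReal.ofReal (M.paidDividends x α z) ∂P.prod (discountMeasure p.ρ) := by
  rw [lintegral_prod _ (M.measurable_paidDividends hα).ennreal_ofReal.aemeasurable]
  exact lintegral_congr fun ω =>
    lintegral_exp_pathMeasure_of_rightContinuous _ _ p.ρ_pos _ (α.Z_rightContinuous ω)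

theorem expectedInjections_eq (hα : M.IsAdmissible x α) : M.expectedInjections x α =
    ∫⁻ z, ENNReal.ofReal (M.paidInjections x α z) ∂P.prod (discountMeasure p.ρ) := by
  rw [lintegral_prod _ (M.measurable_paidInjections hα).ennreal_ofReal.aemeasurable]
  exact lintegral_congr fun ω =>
    lintegral_exp_pathMeasure_of_leftContinuous _ _ p.ρ_pos _ (α.K_leftContinuous ω) (α.K_zero ω)

theorem expectedInjections_ne_top_iff (hα : M.IsAdmissible x α) :
    M.expectedInjections x α ≠ ⊤ ↔
      Integrable (M.paidInjections x α) (P.prod (discountMeasure p.ρ)) := by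
  rw [M.expectedInjections_eq hα]
  exact lintegral_ofReal_ne_top_iff_integrable
    (M.measurable_paidInjections hα).aestronglyMeasurable
    (ae_of_all _ (M.paidInjections_nonneg x α))

theorem reward_eq_bot (h : M.expectedInjections x α = ⊤) : M.reward x α = ⊥ := by
  rw [reward, h, EReal.coe_ennreal_top, EReal.coe_mul_top_of_pos (one_pos.trans p.one_lt_δ),
    EReal.sub_top]

theorem integrable_premium [IsFiniteMeasure P] (x : ℝ) :
    Integrable (fun z : Ω × ℝ≥0 => max 0 x + p.c * z.2) (P.prod (discountMeasure p.ρ)) := by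
  have integrable_coe : Integrable (fun u : ℝ≥0 => (u : ℝ)) (discountMeasure p.ρ) := by
    refine (lintegral_ofReal_ne_top_iff_integrable (by fun_prop)
      (ae_of_all _ fun u => u.2)).1 ?_
    simpa only [ENNReal.ofReal_coe_nnreal] using
      (lintegral_coe_discountMeasure_lt_top p.ρ_pos).ne
  exact (integrable_const _).add ((integrable_coe.comp_snd P).const_mul _)

theorem integrable_paidDividends [IsFiniteMeasure P] (hα : M.IsAdmissible x α)
    (hI : Integrable (M.paidInjections x α) (P.prod (discountMeasure p.ρ))) :
    Integrable (M.paidDividends x α) (P.prod (discountMeasure p.ρ)) :=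
  ((integrable_premium x).add hI).mono' (M.measurable_paidDividends hα).aestronglyMeasurable
    (ae_of_all _ fun z => by
      rw [Real.norm_of_nonneg (M.paidDividends_nonneg x α z)]
      exact M.paidDividends_le hα z)

theorem integrable_netPayout [IsFiniteMeasure P] (hα : M.IsAdmissible x α)
    (hI : Integrable (M.paidInjections x α) (P.prod (discountMeasure p.ρ))) :
    Integrable (M.netPayout x α) (P.prod (discountMeasure p.ρ)) :=
  (M.integrable_paidDividends hα hI).sub (hI.const_mul p.δ)

theorem reward_eq_integral [IsFiniteMeasure P] (hα : M.IsAdmissible x α)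
    (hI : Integrable (M.paidInjections x α) (P.prod (discountMeasure p.ρ))) :
    M.reward x α = ((∫ z, M.netPayout x α z ∂P.prod (discountMeasure p.ρ) : ℝ) : EReal) := by
  have hD := M.integrable_paidDividends hα hI
  have D_nonneg := M.paidDividends_nonneg x α
  have I_nonneg := M.paidInjections_nonneg x α
  simp only [netPayout]
  rw [reward, M.expectedDividends_eq hα, M.expectedInjections_eq hα,
    ← ofReal_integral_eq_lintegral_ofReal hD (ae_of_all _ D_nonneg),
    ← ofReal_integral_eq_lintegral_ofReal hI (ae_of_all _ I_nonneg),
    EReal.coe_ennreal_ofReal, EReal.coe_ennreal_ofReal, max_eq_left (integral_nonneg D_nonneg),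
    max_eq_left (integral_nonneg I_nonneg), integral_sub hD (hI.const_mul p.δ),
    integral_const_mul, EReal.coe_sub, EReal.coe_mul]

theorem value_le [IsFiniteMeasure P] (x : ℝ) : M.value x ≤
    ((∫ z : Ω × ℝ≥0, max 0 x + p.c * z.2 ∂P.prod (discountMeasure p.ρ) : ℝ) : EReal) := by
  refine iSup₂_le fun α hα => ?_
  by_cases hI : M.expectedInjections x α = ⊤
  · exact (M.reward_eq_bot hI).trans_le bot_le
  · have hI := (M.expectedInjections_ne_top_iff hα).1 hI
    rw [M.reward_eq_integral hα hI, EReal.coe_le_coe_iff]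
    exact integral_mono (M.integrable_netPayout hα hI) (integrable_premium x)
      (M.netPayout_le hα)

end HawkesClaims

/-- The strategy that neither pays dividends nor injects capital. -/
noncomputable def Strategy.zero (Ω : Type*) : Strategy Ω where
  Z _ _ := 0
  K _ _ := 0
  Z_mono _ := monotone_const
  Z_rightContinuous _ _ := continuousWithinAt_const
  Z_zero_nonneg _ := le_rfl
  K_mono _ := monotone_const
  K_leftContinuous _ _ := continuousWithinAt_const
  K_zero _ := rfl

namespace HawkesClaims

variable {p : RiskParams} {y : ℝ} {Ω : Type*} [m : MeasurableSpace Ω] {P : Measure Ω}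
  {𝔽 : Filtration ℝ≥0 m} (M : HawkesClaims p y P 𝔽)

theorem isAdmissible_zero (x : ℝ) : M.IsAdmissible x (Strategy.zero Ω) where
  Z_adapted _ := measurable_const
  K_adapted _ := measurable_const
  dividend_le ω t := by
    have no_dividend : prelimit 0 (fun s => (Strategy.zero Ω).Z s ω) t = 0 := by
      rcases eq_or_ne t 0 with rfl | ht
      · exact prelimit_zero _ _
      · exact prelimit_eq_of_tendsto ht tendsto_const_nhds
    rw [no_dividend, sub_zero]
    exact le_max_left _ _

theorem bot_lt_value [IsFiniteMeasure P] (x : ℝ) : ⊥ < M.value x := by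
  have no_injection : M.paidInjections x (Strategy.zero Ω) = 0 := funext fun z =>
    (stopAfter_le monotone_const _ _).antisymm (M.paidInjections_nonneg x _ z)
  have hI : Integrable (M.paidInjections x (Strategy.zero Ω)) (P.prod (discountMeasure p.ρ)) :=
    no_injection ▸ integrable_zero _ _ _
  refine lt_of_lt_of_le ?_ (le_iSup₂_of_le (Strategy.zero Ω) (M.isAdmissible_zero x) le_rfl)
  rw [M.reward_eq_integral (M.isAdmissible_zero x) hI]
  exact EReal.bot_lt_coe _

theorem exists_coe_eq_value [IsFiniteMeasure P] (x : ℝ) : ∃ v : ℝ, (v : EReal) = M.value x :=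
  ⟨_, EReal.coe_toReal ((M.value_le x).trans_lt (EReal.coe_lt_top _)).ne (M.bot_lt_value x).ne'⟩

end HawkesClaims

/-! ### The gain from deferring injections -/

namespace Deferral

variable {p : RiskParams} {y : ℝ} {Ω : Type*} [m : MeasurableSpace Ω] {P : Measure Ω}
  {𝔽 : Filtration ℝ≥0 m} {M : HawkesClaims p y P 𝔽} {x r : ℝ} {α : Strategy Ω}
  (D : Deferral M x r α)

/-- A lower bound for what the deferral saves until the earlier of the times `z.2` and ruin. A unit
still deferred at that time saves its cost `δ` and costs at most one unit of withheld dividends; a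
lump sum injected at ruin is saved altogether. -/
noncomputable def gain (z : Ω × ℝ≥0) : ℝ :=
  (if (stopTime (M.ruinTime x α z.1) z.2 : ℝ≥0∞) ≤ D.σ z.1
    then (p.δ - 1) * D.k (stopTime (M.ruinTime x α z.1) z.2) z.1 else 0) +
  p.δ * (M.paidInjections x α z - α.K (stopTime (M.ruinTime x α z.1) z.2) z.1)

theorem deferral_saving_nonneg (t : ℝ≥0) (ω : Ω) : 0 ≤ (p.δ - 1) * D.k t ω :=
  mul_nonneg (sub_nonneg.2 p.one_lt_δ.le) (D.k_nonneg t ω)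

theorem gain_nonneg (z : Ω × ℝ≥0) : 0 ≤ D.gain z :=
  add_nonneg (by split_ifs <;> [exact D.deferral_saving_nonneg _ _; exact le_rfl])
    (M.mul_paidInjections_sub_nonneg x α z)

theorem measurable_gain (hα : M.IsAdmissible x α) : Measurable D.gain := by
  have stopTime_measurable := M.measurable_stopTime_ruinTime hα
  have σ_measurable := measurable_of_isOptionalTime D.σ_optional
  refine (Measurable.ite ?_ ?_ measurable_const).add
    (((M.measurable_paidInjections hα).sub ?_).const_mul p.δ)
  · exact measurableSet_le stopTime_measurable.coe_nnreal_ennreal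
      (σ_measurable.comp measurable_fst)
  · exact (measurable_eval_of_adapted_of_leftContinuous D.k_adapted D.k_mono D.k_leftContinuous
      stopTime_measurable).const_mul _
  · exact measurable_eval_of_adapted_of_leftContinuous hα.K_adapted α.K_mono α.K_leftContinuous
      stopTime_measurable

/-- The strategy with the injections `D.k` deferred, followed until `α` is ruined. -/
noncomputable def improvement : Strategy Ω := D.strategy.stopped (M.ruinTime x α)

theorem isAdmissible_improvement (hα : M.IsAdmissible x α) :
    M.IsAdmissible (x - r) D.improvement :=
  (D.isAdmissible_strategy hα).stopped (M.isOptionalTime_ruinTime hα)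

theorem ruinTime_le_ruinTime_improvement (ω : Ω) :
    M.ruinTime x α ω ≤ M.ruinTime (x - r) D.improvement ω :=
  M.le_ruinTime fun _ ht =>
    (D.surplusAfter_strategy_nonneg ht).trans_eq (M.surplusAfter_stopped ht).symm

theorem paidDividends_improvement (z : Ω × ℝ≥0) : M.paidDividends (x - r) D.improvement z =
    D.strategy.Z (stopTime (M.ruinTime x α z.1) z.2) z.1 := by
  have stopTime_eq : stopTime (M.ruinTime x α z.1)
      (stopTime (M.ruinTime (x - r) D.improvement z.1) z.2) =
      stopTime (M.ruinTime x α z.1) z.2 := by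
    rw [← ENNReal.coe_inj, coe_stopTime, coe_stopTime, coe_stopTime, min_assoc,
      min_eq_right (D.ruinTime_le_ruinTime_improvement z.1)]
  exact congrArg (D.strategy.Z · z.1) stopTime_eq

theorem paidInjections_improvement_le (z : Ω × ℝ≥0) : M.paidInjections (x - r) D.improvement z ≤
    D.strategy.K (stopTime (M.ruinTime x α z.1) z.2) z.1 :=
  stopAfter_le (D.improvement.K_mono z.1) _ _

theorem strategy_K_le (t : ℝ≥0) (ω : Ω) : D.strategy.K t ω ≤ α.K t ω + r := by
  have K_le := deferredK_le (K := fun s => α.K s ω) (σ := D.σ ω) (α.Z_mono ω)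
    (α.Z_zero_nonneg ω) (D.k_nonneg · ω) t
  rwa [D.k_zero] at K_le

theorem netPayout_add_gain_le (z : Ω × ℝ≥0) :
    M.netPayout x α z + D.gain z - p.δ * r ≤ M.netPayout (x - r) D.improvement z := by
  have payout_le := add_mul_deferredK_le (K := fun s => α.K s z.1) (σ := D.σ z.1)
    (α.Z_mono z.1) (D.k_mono z.1) p.one_lt_δ.le (α.Z_zero_nonneg z.1) (D.k_nonneg · z.1)
    (stopTime (M.ruinTime x α z.1) z.2)
  have injections_le := mul_le_mul_of_nonneg_left (D.paidInjections_improvement_le z)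
    (zero_le_one.trans p.one_lt_δ.le)
  rw [D.k_zero] at payout_le
  rw [strategy_K] at injections_le
  rw [HawkesClaims.netPayout, HawkesClaims.netPayout, gain, D.paidDividends_improvement,
    strategy_Z, HawkesClaims.paidDividends]
  linarith

variable [IsProbabilityMeasure P]

theorem integrable_paidInjections_improvement (hα : M.IsAdmissible x α)
    (hI : Integrable (M.paidInjections x α) (P.prod (discountMeasure p.ρ))) :
    Integrable (M.paidInjections (x - r) D.improvement) (P.prod (discountMeasure p.ρ)) :=
  (hI.add (integrable_const r)).mono'
    (M.measurable_paidInjections (D.isAdmissible_improvement hα)).aestronglyMeasurable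
    (ae_of_all _ fun z => by
      rw [Real.norm_of_nonneg (M.paidInjections_nonneg _ _ z)]
      exact ((D.paidInjections_improvement_le z).trans (D.strategy_K_le _ _)).trans
        (by simpa using M.le_paidInjections x α z))

theorem integrable_gain (hα : M.IsAdmissible x α)
    (hI : Integrable (M.paidInjections x α) (P.prod (discountMeasure p.ρ))) :
    Integrable D.gain (P.prod (discountMeasure p.ρ)) := by
  have improved_integrable := M.integrable_netPayout (D.isAdmissible_improvement hα)
    (D.integrable_paidInjections_improvement hα hI)
  refine ((improved_integrable.sub (M.integrable_netPayout hα hI)).add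
    (integrable_const (p.δ * r))).mono' (D.measurable_gain hα).aestronglyMeasurable
    (ae_of_all _ fun z => ?_)
  rw [Real.norm_of_nonneg (D.gain_nonneg z)]
  simp only [Pi.add_apply, Pi.sub_apply]
  linarith [D.netPayout_add_gain_le z]

theorem integral_netPayout_add_integral_gain_le_value (hα : M.IsAdmissible x α)
    (hI : Integrable (M.paidInjections x α) (P.prod (discountMeasure p.ρ))) :
    ((∫ z, M.netPayout x α z ∂P.prod (discountMeasure p.ρ) +
      ∫ z, D.gain z ∂P.prod (discountMeasure p.ρ) - p.δ * r : ℝ) : EReal) ≤ M.value (x - r) := by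
  have improvement_admissible := D.isAdmissible_improvement hα
  have improvement_integrable := D.integrable_paidInjections_improvement hα hI
  have payout_integrable := M.integrable_netPayout hα hI
  have gain_integrable := D.integrable_gain hα hI
  refine le_trans ?_ (le_iSup₂_of_le D.improvement improvement_admissible
    (M.reward_eq_integral improvement_admissible improvement_integrable).ge)
  rw [EReal.coe_le_coe_iff]
  have integral_le := integral_mono
    ((payout_integrable.add gain_integrable).sub (integrable_const (p.δ * r)))
    (M.integrable_netPayout improvement_admissible improvement_integrable)
    D.netPayout_add_gain_le
  rwa [integral_sub' (payout_integrable.add gain_integrable) (integrable_const _),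
    integral_add' payout_integrable gain_integrable, integral_const, probReal_univ,
    one_smul] at integral_le

end Deferral

/-! ### Injecting capital at a positive surplus -/

namespace HawkesClaims

variable {p : RiskParams} {y : ℝ} {Ω : Type*} [m : MeasurableSpace Ω] {P : Measure Ω}
  {𝔽 : Filtration ℝ≥0 m} (M : HawkesClaims p y P 𝔽) {x κ : ℝ} {α : Strategy Ω}

/-- The event that the exponential time `z.2` comes no later than the first claim. -/
def beforeFirstClaim : Set (Ω × ℝ≥0) := {z | (z.2 : ℝ≥0∞) ≤ M.claimTime 1 z.1}

theorem measurableSet_beforeFirstClaim : MeasurableSet M.beforeFirstClaim :=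
  measurableSet_le measurable_snd.coe_nnreal_ennreal
    ((measurable_of_isOptionalTime (M.isOptionalTime_claimTime 1)).comp measurable_fst)

theorem measureReal_beforeFirstClaim_pos [IsProbabilityMeasure P] :
    0 < (P.prod (discountMeasure p.ρ)).real M.beforeFirstClaim := by
  refine ENNReal.toReal_pos (fun null => ?_) (measure_ne_top _ _)
  obtain ⟨ω, hω⟩ := (Measure.ae_ae_of_ae_prod (measure_eq_zero_iff_ae_notMem.1 null)).exists
  obtain ⟨s, hs_pos, hs⟩ := ENNReal.lt_iff_exists_nnreal_btwn.1 (M.claimTime_one_pos ω)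
  obtain ⟨u, ⟨-, hus⟩, hu⟩ :=
    exists_mem_Ioc_of_ae_discountMeasure p.ρ_pos hω (ENNReal.coe_pos.1 hs_pos)
  exact hu ((ENNReal.coe_le_coe.2 hus).trans hs.le)

theorem indicator_beforeFirstClaim_le_gain (hx : 0 ≤ x) (hκ : 0 ≤ κ) (z : Ω × ℝ≥0) :
    M.beforeFirstClaim.indicator (fun _ => (p.δ - 1) * κ) z ≤
      (M.initialDeferral hx hκ α).gain z := by
  refine indicator_apply_le' (fun hz => ?_) fun _ => Deferral.gain_nonneg _ z
  have stopTime_le_claim :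
      (stopTime (M.ruinTime (x + κ) α z.1) z.2 : ℝ≥0∞) ≤ M.claimTime 1 z.1 :=
    (ENNReal.coe_le_coe.2 (stopTime_le _ _)).trans hz
  rw [Deferral.gain]
  refine le_add_of_le_of_nonneg (le_of_eq ?_) (M.mul_paidInjections_sub_nonneg (x + κ) α z)
  exact (if_pos stopTime_le_claim).symm

theorem le_integral_gain_initialDeferral [IsProbabilityMeasure P] (hx : 0 ≤ x) (hκ : 0 ≤ κ)
    (hα : M.IsAdmissible (x + κ) α)
    (hI : Integrable (M.paidInjections (x + κ) α) (P.prod (discountMeasure p.ρ))) :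
    (P.prod (discountMeasure p.ρ)).real M.beforeFirstClaim * ((p.δ - 1) * κ) ≤
      ∫ z, (M.initialDeferral hx hκ α).gain z ∂P.prod (discountMeasure p.ρ) := by
  rw [← smul_eq_mul, ← integral_indicator_const _ M.measurableSet_beforeFirstClaim]
  exact integral_mono
    ((integrable_const _).indicator M.measurableSet_beforeFirstClaim)
    (Deferral.integrable_gain _ hα hI) (M.indicator_beforeFirstClaim_le_gain hx hκ)

theorem reward_add_le [IsProbabilityMeasure P] {v : ℝ} (hv : v = M.value x) (hx : 0 ≤ x)
    (hκ : 0 ≤ κ) (hα : M.IsAdmissible (x + κ) α) : M.reward (x + κ) α ≤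
      ((v + p.δ * κ -
        (P.prod (discountMeasure p.ρ)).real M.beforeFirstClaim * ((p.δ - 1) * κ) : ℝ) : EReal) := by
  by_cases hI : M.expectedInjections (x + κ) α = ⊤
  · exact (M.reward_eq_bot hI).trans_le bot_le
  have injections_integrable := (M.expectedInjections_ne_top_iff hα).1 hI
  have le_value := Deferral.integral_netPayout_add_integral_gain_le_value
    (M.initialDeferral hx hκ α) hα injections_integrable
  rw [add_sub_cancel_right, ← hv, EReal.coe_le_coe_iff] at le_value
  rw [M.reward_eq_integral hα injections_integrable, EReal.coe_le_coe_iff]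
  linarith [M.le_integral_gain_initialDeferral hx hκ hα injections_integrable]

theorem value_add_sub_lt_value [IsProbabilityMeasure P] (hx : 0 ≤ x) (hκ : 0 < κ) :
    M.value (x + κ) - ((p.δ * κ : ℝ) : EReal) < M.value x := by
  obtain ⟨v, hv⟩ := M.exists_coe_eq_value x
  obtain ⟨w, hw⟩ := M.exists_coe_eq_value (x + κ)
  have value_le : M.value (x + κ) ≤ _ := iSup₂_le fun α hα => M.reward_add_le hv hx hκ.le hα
  have gain_pos := mul_pos M.measureReal_beforeFirstClaim_pos
    (mul_pos (sub_pos.2 p.one_lt_δ) hκ)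
  rw [← hw, EReal.coe_le_coe_iff] at value_le
  rw [← hv, ← hw, ← EReal.coe_sub, EReal.coe_lt_coe_iff]
  linarith

end HawkesClaims

/-! ### Injections under an optimal strategy -/

namespace Deferral

variable {p : RiskParams} {y : ℝ} {Ω : Type*} [m : MeasurableSpace Ω] {P : Measure Ω}
  {𝔽 : Filtration ℝ≥0 m} {M : HawkesClaims p y P 𝔽} {x r : ℝ} {α : Strategy Ω}

theorem ae_gain_eq_zero_of_reward_eq_value [IsProbabilityMeasure P] (D : Deferral M x 0 α)
    (hα : M.IsAdmissible x α) (hopt : M.reward x α = M.value x) :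
    ∀ᵐ ω ∂P, ∀ᵐ u ∂discountMeasure p.ρ, D.gain (ω, u) = 0 := by
  have hI : M.expectedInjections x α ≠ ⊤ := fun h =>
    (M.bot_lt_value x).ne' (hopt ▸ M.reward_eq_bot h)
  rw [M.expectedInjections_ne_top_iff hα] at hI
  have le_value := D.integral_netPayout_add_integral_gain_le_value hα hI
  rw [mul_zero, sub_zero, sub_zero, ← hopt, M.reward_eq_integral hα hI, EReal.coe_le_coe_iff,
    add_le_iff_nonpos_right] at le_value
  have integral_gain_eq_zero := le_value.antisymm (integral_nonneg D.gain_nonneg)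
  rw [integral_eq_zero_iff_of_nonneg D.gain_nonneg (D.integrable_gain hα hI)]
    at integral_gain_eq_zero
  exact Measure.ae_ae_of_ae_prod integral_gain_eq_zero

variable (D : Deferral M x r α) {z : Ω × ℝ≥0}

theorem k_eq_zero_of_gain_eq_zero (h : D.gain z = 0)
    (hσ : stopTime (M.ruinTime x α z.1) z.2 ≤ D.σ z.1) :
    D.k (stopTime (M.ruinTime x α z.1) z.2) z.1 = 0 := by
  rw [gain, if_pos hσ, add_eq_zero_iff_of_nonneg (D.deferral_saving_nonneg _ _)
    (M.mul_paidInjections_sub_nonneg x α z)] at h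
  exact (mul_eq_zero.1 h.1).resolve_left (sub_pos.2 p.one_lt_δ).ne'

theorem paidInjections_eq_of_gain_eq_zero (h : D.gain z = 0) :
    M.paidInjections x α z = α.K (stopTime (M.ruinTime x α z.1) z.2) z.1 := by
  rw [gain, add_eq_zero_iff_of_nonneg (by
    split_ifs <;> [exact D.deferral_saving_nonneg _ _; exact le_rfl])
    (M.mul_paidInjections_sub_nonneg x α z)] at h
  exact sub_eq_zero.1 ((mul_eq_zero.1 h.2).resolve_left (one_pos.trans p.one_lt_δ).ne')

end Deferral

theorem Strategy.dK_singleton {Ω : Type*} (α : Strategy Ω) (ω : Ω) (t : ℝ≥0) : α.dK ω {(t : ℝ)} =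
    ENNReal.ofReal (Function.rightLim (fun s => α.K s ω) t - α.K t ω) := by
  rw [Strategy.dK, pathMeasure_singleton, ← α.K_zero ω,
    prelimit_of_continuousWithinAt_Iic (g := fun s => α.K s ω) (α.K_leftContinuous ω t)]

theorem Strategy.dK_Ioo {Ω : Type*} (α : Strategy Ω) (ω : Ω) (s t : ℝ≥0) :
    α.dK ω (Ioo (s : ℝ) t) =
      ENNReal.ofReal (α.K t ω - Function.rightLim (fun s => α.K s ω) s) := by
  rw [Strategy.dK, pathMeasure_Ioo, ← α.K_zero ω,
    prelimit_of_continuousWithinAt_Iic (g := fun s => α.K s ω) (α.K_leftContinuous ω t)]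

namespace HawkesClaims

variable {p : RiskParams} {y : ℝ} {Ω : Type*} [m : MeasurableSpace Ω] {P : Measure Ω}
  {𝔽 : Filtration ℝ≥0 m} (M : HawkesClaims p y P 𝔽) {x : ℝ} {α : Strategy Ω} {ω : Ω}

theorem ae_dK_ofReal_ne_ruinTime
    (h : ∀ᵐ u ∂discountMeasure p.ρ,
      M.paidInjections x α (ω, u) = α.K (stopTime (M.ruinTime x α ω) u) ω) :
    ∀ᵐ t ∂α.dK ω, 0 ≤ t → ENNReal.ofReal t ≠ M.ruinTime x α ω := by
  rcases eq_or_ne (M.ruinTime x α ω) ⊤ with hT | hT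
  · exact ae_of_all _ fun t _ => hT ▸ ENNReal.ofReal_ne_top
  obtain ⟨T, hT⟩ : ∃ T : ℝ≥0, M.ruinTime x α ω = T := ⟨_, (ENNReal.coe_toNNReal hT).symm⟩
  obtain ⟨u, ⟨hTu, -⟩, hu⟩ := exists_mem_Ioc_of_ae_discountMeasure p.ρ_pos h (lt_add_one T)
  have no_lump_sum : Function.rightLim (fun s => α.K s ω) T = α.K T ω := by
    rwa [paidInjections, hT, stopAfter_of_lt _ (ENNReal.coe_lt_coe.2 hTu), ENNReal.toNNReal_coe,
      stopTime_coe, min_eq_right hTu.le] at hu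
  have null : α.dK ω {(T : ℝ)} = 0 := by
    rw [α.dK_singleton, no_lump_sum, sub_self, ENNReal.ofReal_zero]
  filter_upwards [measure_eq_zero_iff_ae_notMem.1 null] with t ht ht_nonneg heq
  lift t to ℝ≥0 using ht_nonneg
  rw [hT, ENNReal.ofReal_coe_nnreal, ENNReal.coe_inj] at heq
  exact ht (mem_singleton_iff.2 (congrArg _ heq))

theorem rightLim_K_of_excess_eq_zero {n : ℕ} {τ u : ℝ≥0} (hτ : M.claimTime n ω = τ)
    (hτT : τ < M.ruinTime x α ω) (hτu : τ < u) (hu : M.excess x α n u ω = 0) :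
    Function.rightLim (fun s => α.K s ω) τ = α.K τ ω + M.shortfall x α n ω := by
  refine le_antisymm ?_ (ge_of_tendsto ((α.K_mono ω).tendsto_rightLim τ) ?_)
  · rw [← M.sub_excess_of_lt hτ hτT hτu, hu, sub_zero]
    exact (α.K_mono ω).rightLim_le hτu
  · filter_upwards [self_mem_nhdsWithin] with s hs
    linarith [M.shortfall_le_of_lt_ruinTime hτ hτT hs]

/-- The surplus is negative at time `t` and is brought exactly to `0` by an injection at `t`. -/
def IsRestored (x : ℝ) (α : Strategy Ω) (ω : Ω) (t : ℝ≥0) : Prop :=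
  M.surplus x α t ω < 0 ∧ M.surplusAfter x α t ω = 0

theorem isRestored_of_shortfall_pos {n : ℕ} {τ : ℝ≥0} (hτ : M.claimTime n ω = τ)
    (hK : Function.rightLim (fun s => α.K s ω) τ = α.K τ ω + M.shortfall x α n ω)
    (hpos : 0 < M.shortfall x α n ω) : M.IsRestored x α ω τ := by
  have surplus_neg : M.surplus x α τ ω < 0 := by simpa [shortfall, hτ] using hpos
  refine ⟨surplus_neg, ?_⟩
  rw [surplusAfter_eq, hK, shortfall, hτ, ENNReal.toNNReal_coe,
    max_eq_right (neg_nonneg.2 surplus_neg.le), surplus]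
  ring

theorem ae_dK_isRestored_of_excess_eq_zero {n : ℕ} {τ u : ℝ≥0} (hτ : M.claimTime n ω = τ)
    (hτT : τ < M.ruinTime x α ω) (hτu : τ < u) (hu : M.excess x α n u ω = 0) :
    ∀ᵐ t ∂α.dK ω, t ∈ Ico (τ : ℝ) u → M.IsRestored x α ω t.toNNReal := by
  have rightLim_eq := M.rightLim_K_of_excess_eq_zero hτ hτT hτu hu
  have K_eq := M.sub_excess_of_lt hτ hτT hτu
  rw [hu, sub_zero] at K_eq
  have null_after : α.dK ω (Ioo (τ : ℝ) u) = 0 := by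
    rw [α.dK_Ioo, K_eq, rightLim_eq, sub_self, ENNReal.ofReal_zero]
  have restored_at_claim : ∀ᵐ t ∂α.dK ω, t = (τ : ℝ) → M.IsRestored x α ω τ := by
    rcases (M.shortfall_nonneg x α n ω).eq_or_lt with hzero | hpos
    · have null_at_claim : α.dK ω {(τ : ℝ)} = 0 := by
        rw [α.dK_singleton, rightLim_eq, ← hzero, add_zero, sub_self, ENNReal.ofReal_zero]
      exact (measure_eq_zero_iff_ae_notMem.1 null_at_claim).mono fun t ht heq => absurd heq ht
    · exact ae_of_all _ fun _ _ => M.isRestored_of_shortfall_pos hτ rightLim_eq hpos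
  filter_upwards [measure_eq_zero_iff_ae_notMem.1 null_after, restored_at_claim]
    with t h_not_after h_at_claim ⟨hτt, htu⟩
  obtain rfl : (τ : ℝ) = t := hτt.eq_of_not_lt fun hlt => h_not_after ⟨hlt, htu⟩
  rw [Real.toNNReal_coe]
  exact h_at_claim rfl

theorem exists_excess_eq_zero {hα : M.IsAdmissible x α} {n : ℕ}
    (h : ∀ᵐ u ∂discountMeasure p.ρ, (M.excessDeferral hα n).gain (ω, u) = 0) {t : ℝ≥0}
    (htT : t < M.ruinTime x α ω) (htσ : t < M.claimTime (n + 1) ω) :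
    ∃ u > t, M.excess x α n u ω = 0 := by
  obtain ⟨s, hts, hs⟩ := ENNReal.lt_iff_exists_nnreal_btwn.1 (lt_min htT htσ)
  obtain ⟨u, ⟨htu, hus⟩, hu⟩ :=
    exists_mem_Ioc_of_ae_discountMeasure p.ρ_pos h (ENNReal.coe_lt_coe.1 hts)
  have u_le := (ENNReal.coe_le_coe.2 hus).trans hs.le
  have stopTime_eq : stopTime (M.ruinTime x α ω) u = u :=
    stopTime_of_le (u_le.trans (min_le_left _ _))
  have excess_eq_zero := (M.excessDeferral hα n).k_eq_zero_of_gain_eq_zero hu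
    (stopTime_eq.symm ▸ u_le.trans (min_le_right _ _))
  rw [stopTime_eq] at excess_eq_zero
  exact ⟨u, htu, excess_eq_zero⟩

theorem ae_dK_isRestored_of_N_eq {hα : M.IsAdmissible x α} {n : ℕ}
    (h : ∀ᵐ u ∂discountMeasure p.ρ, (M.excessDeferral hα n).gain (ω, u) = 0) :
    ∀ᵐ t ∂α.dK ω, 0 ≤ t → ENNReal.ofReal t < M.ruinTime x α ω → M.N t.toNNReal ω = n →
      M.IsRestored x α ω t.toNNReal := by
  refine measure_null_of_locally_null _ fun t ht => ?_
  simp only [mem_compl_iff, mem_ofPred_eq, Classical.not_imp] at ht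
  obtain ⟨ht_nonneg, htT, htN, -⟩ := ht
  lift t to ℝ≥0 using ht_nonneg
  rw [ENNReal.ofReal_coe_nnreal] at htT
  rw [Real.toNNReal_coe] at htN
  obtain ⟨τ, hτ, hτt⟩ := ENNReal.le_coe_iff.1 (M.claimTime_le_iff.2 htN.ge)
  obtain ⟨u, htu, hu⟩ :=
    M.exists_excess_eq_zero h htT (M.lt_claimTime_iff.2 (htN.trans_lt (Nat.lt_succ_self n)))
  refine ⟨_, inter_mem_nhdsWithin _ (Iio_mem_nhds (NNReal.coe_lt_coe.2 htu)),
    measure_mono_null (fun s ⟨hs, hsu⟩ => ?_) (M.ae_dK_isRestored_of_excess_eq_zero hτ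
      ((ENNReal.coe_le_coe.2 hτt).trans_lt htT) (hτt.trans_lt htu) hu)⟩
  simp only [mem_compl_iff, mem_ofPred_eq, Classical.not_imp] at hs ⊢
  obtain ⟨hs_nonneg, -, hsN, hs_not_restored⟩ := hs
  have claimTime_le := M.claimTime_le_iff.2 hsN.ge
  rw [hτ, ENNReal.coe_le_coe, Real.le_toNNReal_iff_coe_le hs_nonneg] at claimTime_le
  exact ⟨⟨claimTime_le, hsu⟩, hs_not_restored⟩

theorem ae_dK_isRestored_of_reward_eq_value [IsProbabilityMeasure P] (hα : M.IsAdmissible x α)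
    (hopt : M.reward x α = M.value x) :
    ∀ᵐ ω ∂P, ∀ᵐ t ∂α.dK ω, ENNReal.ofReal t ≤ M.ruinTime x α ω →
      M.IsRestored x α ω t.toNNReal := by
  filter_upwards [ae_all_iff.2 fun n =>
    (M.excessDeferral hα n).ae_gain_eq_zero_of_reward_eq_value hα hopt] with ω no_gain
  have nonneg : ∀ᵐ t ∂α.dK ω, t ∉ Iio 0 :=
    measure_eq_zero_iff_ae_notMem.1 (pathMeasure_Iio_zero _ _)
  have ne_ruinTime := M.ae_dK_ofReal_ne_ruinTime ((no_gain 0).mono fun u =>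
    (M.excessDeferral hα 0).paidInjections_eq_of_gain_eq_zero (z := (ω, u)))
  filter_upwards [nonneg, ne_ruinTime, ae_all_iff.2 fun n => M.ae_dK_isRestored_of_N_eq (no_gain n)]
    with t ht_not_neg ht_ne_ruinTime ht_restored ht
  have ht_nonneg := notMem_Iio.1 ht_not_neg
  exact ht_restored _ ht_nonneg (ht.lt_of_ne (ht_ne_ruinTime ht_nonneg)) rfl

end HawkesClaims

theorem mainTheorem5_general (p : RiskParams) (y : ℝ)
    {Ω : Type*} [m : MeasurableSpace Ω] (P : Measure Ω) [IsProbabilityMeasure P]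
    (𝔽 : Filtration ℝ≥0 m) (M : HawkesClaims p y P 𝔽) :
    (∀ x κ : ℝ, 0 ≤ x → 0 < κ →
      M.value (x + κ) - ((p.δ * κ : ℝ) : EReal) < M.value x) ∧
    (∀ (x : ℝ) (α : Strategy Ω), M.IsAdmissible x α → M.reward x α = M.value x →
      ∀ᵐ ω ∂P, ∀ᵐ t ∂(α.dK ω), ENNReal.ofReal t ≤ M.ruinTime x α ω →
        M.surplus x α t.toNNReal ω < 0 ∧ M.surplusAfter x α t.toNNReal ω = 0) :=
  ⟨fun _ _ hx hκ => M.value_add_sub_lt_value hx hκ,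
    fun _ _ hα hopt => M.ae_dK_isRestored_of_reward_eq_value hα hopt⟩

theorem mainTheorem5 (p : RiskParams) (y : ℝ) (hy : p.b ≤ y)
    {Ω : Type*} [m : MeasurableSpace Ω] (P : Measure Ω) [IsProbabilityMeasure P]
    (𝔽 : Filtration ℝ≥0 m) (M : HawkesClaims p y P 𝔽) :
    (∀ x κ : ℝ, 0 ≤ x → 0 < κ →
      M.value (x + κ) - ((p.δ * κ : ℝ) : EReal) < M.value x) ∧
    (∀ (x : ℝ) (α : Strategy Ω), M.IsAdmissible x α → M.reward x α = M.value x →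
      ∀ᵐ ω ∂P, ∀ᵐ t ∂(α.dK ω), ENNReal.ofReal t ≤ M.ruinTime x α ω →
        M.surplus x α t.toNNReal ω < 0 ∧ M.surplusAfter x α t.toNNReal ω = 0) :=
  mainTheorem5_general p y P 𝔽 M
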